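/- Let $G$ be a compact connected Lie group of adjoint type (that is, with trivial centre), $T$ a maximal torus of $G$, $W=N_G(T)/T$ the Weyl group, $\mathfrak t$ the Lie algebra of $T$, $\exp:\mathfrak t\to T$ the exponential map and $\Gamma(T)=\ker(\exp)$. The group $W$ acts on $T$ by conjugation and on $\mathfrak t$ by the adjoint action, and preserves $\Gamma(T)$; the extended affine Weyl group $W'_a=\Gamma(T)\rtimes W$ acts on $\mathfrak t$ by $(\gamma w)(x)=\gamma+w(x)$. A root is a nonzero linear form $\alpha:\mathfrak t\to\mathbb R$ for which there is a nonzero $Z\in\mathfrak g\otimes_{\mathbb R}\mathbb C$, $\mathfrak g$ being the Lie algebra of $G$, with $\mathrm{Ad}(\exp X)Z=e^{2\pi i\alpha(X)}Z$ for all $X\in\mathfrak t$; the singular hyperplanes are the sets $\{x\in\mathfrak t:\alpha(x)=k\}$ with $\alpha$ a root and $k\in\mathbb Z$, and the alcoves are the connected components of the complement $\mathfrak t_r$ of their union. Let $A$ be an alcove, let $x_0$ be its barycentre, i.e. the mean of the vertices (extreme points) of the polytope $\overline A$ (a simplex if $G$ is simple), and let $t_0=\exp x_0$. Let $W(t_0)$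 be the stabilizer of $t_0$ in $W$ and $H_A$ the stabilizer of $A$ in $W'_a$. Then for every $w\in W(t_0)$ there is a unique $\gamma\in\Gamma(T)$ with $\gamma w(x_0)=x_0$, and there is a unique group isomorphism $$W(t_0)\;\simeq\;H_A$$ that sends each $w\in W(t_0)$ to $\gamma w$, where $\gamma$ is this element of $\Gamma(T)$. -/

import Mathlib

open scoped Manifold ContDiff Topology Pointwise

noncomputable section

namespace AlcoveLie
variable {E : Type*} [NormedAddCommGroup E] [NormedSpace ℝ E]
  {G : Type*} [TopologicalSpace G] [ChartedSpace E G] [Group G]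

/-- `φ : ℝ → G` is a one-parameter subgroup of `G` with velocity `X ∈ T_1 G` at `0`.
As `φ 0 = 1`, the tangent space at `φ 0` is the tangent space at `1`; differentiability at `0`
forces a one-parameter subgroup to be smooth. -/
structure IsOneParam (φ : ℝ → G) (X : GroupLieAlgebra 𝓘(ℝ, E) G) : Prop where
  map_add : ∀ s u, φ (s + u) = φ s * φ u
  hasMFDerivAt_zero : HasMFDerivAt 𝓘(ℝ, ℝ) 𝓘(ℝ, E) φ 0 (ContinuousLinearMap.toSpanSingleton ℝ X)

variable (E) in
/-- The adjoint representation of `G` on its Lie algebra: the derivative at `1` of conjugation by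
`g` (which fixes `1`). -/
def Ad (g : G) : GroupLieAlgebra 𝓘(ℝ, E) G →L[ℝ] GroupLieAlgebra 𝓘(ℝ, E) G :=
  mfderiv 𝓘(ℝ, E) 𝓘(ℝ, E) (fun h : G => g * h * g⁻¹) 1

theorem hasMFDerivAt_mul_of_eq_one [LieGroup 𝓘(ℝ, E) ∞ G] {a b : G} (ha : a = 1) (hb : b = 1) :
    HasMFDerivAt (𝓘(ℝ, E).prod 𝓘(ℝ, E)) 𝓘(ℝ, E) (fun p : G × G => p.1 * p.2) (a, b)
      (ContinuousLinearMap.fst ℝ E E + ContinuousLinearMap.snd ℝ E E) := by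
  subst ha hb
  have hd : MDifferentiableAt (𝓘(ℝ, E).prod 𝓘(ℝ, E)) 𝓘(ℝ, E)
      (fun p : G × G => p.1 * p.2) (1, 1) :=
    ((contMDiff_mul 𝓘(ℝ, E) ∞).mdifferentiable (by simp)) _
  have h1 : mfderiv (𝓘(ℝ, E).prod 𝓘(ℝ, E)) 𝓘(ℝ, E) (fun p : G × G => p.1 * p.2) (1, 1) =
      (ContinuousLinearMap.fst ℝ E E + ContinuousLinearMap.snd ℝ E E) := by
    refine ContinuousLinearMap.ext fun v => ?_
    refine (mfderiv_prod_eq_add_apply hd).trans ?_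
    have e1 : (fun z : G => z * (1 : G)) = id := by funext z; simp
    have e2 : (fun z : G => (1 : G) * z) = id := by funext z; simp
    have f1 : mfderiv 𝓘(ℝ, E) 𝓘(ℝ, E) (fun z : G => z * (1 : G)) 1 =
        ContinuousLinearMap.id ℝ E := by rw [e1]; exact mfderiv_id
    have f2 : mfderiv 𝓘(ℝ, E) 𝓘(ℝ, E) (fun z : G => (1 : G) * z) 1 =
        ContinuousLinearMap.id ℝ E := by rw [e2]; exact mfderiv_id
    exact congrArg₂ (fun a b : E => a + b) (DFunLike.congr_fun f1 v.1) (DFunLike.congr_fun f2 v.2)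
  have := hd.hasMFDerivAt
  rw [h1] at this
  exact this

theorem hasMFDerivAt_Ad [LieGroup 𝓘(ℝ, E) ∞ G] (g : G) {a : G} (ha : a = 1) :
    HasMFDerivAt 𝓘(ℝ, E) 𝓘(ℝ, E) (fun h : G => g * h * g⁻¹) a (Ad E g) := by
  subst ha
  have hd : MDifferentiableAt 𝓘(ℝ, E) 𝓘(ℝ, E) (fun h : G => g * h * g⁻¹) 1 := by
    have : ContMDiff 𝓘(ℝ, E) 𝓘(ℝ, E) ∞ (fun h : G => g * h * g⁻¹) :=
      (contMDiff_const.mul contMDiff_id).mul contMDiff_const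
    exact this.mdifferentiable (by simp) _
  exact hd.hasMFDerivAt

theorem Ad_one : Ad E (1 : G) = ContinuousLinearMap.id ℝ _ := by
  have e : (fun h : G => 1 * h * 1⁻¹) = id := by funext z; simp
  unfold Ad
  rw [e]
  exact mfderiv_id

theorem Ad_mul [LieGroup 𝓘(ℝ, E) ∞ G] (g h : G) : Ad E (g * h) = (Ad E g).comp (Ad E h) := by
  have h1 := hasMFDerivAt_Ad (E := E) h (a := 1) rfl
  have h2 := hasMFDerivAt_Ad (E := E) g (a := h * 1 * h⁻¹) (by simp)
  have h3 := h2.comp (1 : G) h1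
  have e : ((fun k : G => g * k * g⁻¹) ∘ fun k => h * k * h⁻¹) = fun k => g * h * k * (g * h)⁻¹ := by
    funext k; simp [mul_assoc]
  rw [e] at h3
  exact h3.mfderiv

namespace IsOneParam
variable {φ ψ : ℝ → G} {X Y : GroupLieAlgebra 𝓘(ℝ, E) G}

theorem map_zero (h : IsOneParam φ X) : φ 0 = 1 := by
  have := h.map_add 0 0
  simpa using this

theorem const : IsOneParam (fun _ : ℝ => (1 : G)) (0 : GroupLieAlgebra 𝓘(ℝ, E) G) := by
  refine ⟨by simp, ?_⟩
  have := hasMFDerivAt_const (I := 𝓘(ℝ, ℝ)) (I' := 𝓘(ℝ, E)) (1 : G) (0 : ℝ)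
  exact this.congr_mfderiv (ContinuousLinearMap.toSpanSingleton_zero ℝ).symm

theorem mul [LieGroup 𝓘(ℝ, E) ∞ G] (h : IsOneParam φ X) (h' : IsOneParam ψ Y)
    (hc : ∀ s u, Commute (φ s) (ψ u)) : IsOneParam (fun s => φ s * ψ s) (X + Y) := by
  refine ⟨fun s u => ?_, ?_⟩
  · rw [h.map_add, h'.map_add, mul_assoc, mul_assoc, ← mul_assoc (φ u), (hc u s).eq, mul_assoc]
  · have := (hasMFDerivAt_mul_of_eq_one (E := E) h.map_zero h'.map_zero).comp (0 : ℝ)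
      (h.hasMFDerivAt_zero.prodMk h'.hasMFDerivAt_zero)
    exact this.congr_mfderiv (ContinuousLinearMap.toSpanSingleton_add ℝ X Y).symm

theorem smul (h : IsOneParam φ X) (c : ℝ) : IsOneParam (fun s => φ (c * s)) (c • X) := by
  refine ⟨fun s u => by rw [mul_add, h.map_add], ?_⟩
  have h1 : HasMFDerivAt 𝓘(ℝ, ℝ) 𝓘(ℝ, ℝ) (fun s : ℝ => c * s) 0
      (ContinuousLinearMap.toSpanSingleton ℝ c) := by
    apply HasFDerivAt.hasMFDerivAt
    exact ((hasDerivAt_id (0 : ℝ)).const_mul c).hasFDerivAt.congr_fderiv (by rw [mul_one]; rfl)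
  have h2 : HasMFDerivAt 𝓘(ℝ, ℝ) 𝓘(ℝ, E) φ (c * 0) (ContinuousLinearMap.toSpanSingleton ℝ X) := by
    rw [mul_zero]; exact h.hasMFDerivAt_zero
  refine (h2.comp (f := fun s : ℝ => c * s) (0 : ℝ) h1).congr_mfderiv ?_
  refine ContinuousLinearMap.ext fun v => ?_
  exact mul_smul (α := ℝ) v c X

theorem conj [LieGroup 𝓘(ℝ, E) ∞ G] (h : IsOneParam φ X) (g : G) :
    IsOneParam (fun s => g * φ s * g⁻¹) (Ad E g X) := by
  refine ⟨fun s u => by simp [h.map_add, mul_assoc], ?_⟩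
  exact ((hasMFDerivAt_Ad (E := E) g h.map_zero).comp (0 : ℝ) h.hasMFDerivAt_zero).congr_mfderiv
    (ContinuousLinearMap.comp_toSpanSingleton (Ad E g) X)

theorem velocity_unique (h : IsOneParam φ X) (h' : IsOneParam φ Y) : X = Y := by
  have := hasMFDerivAt_unique h.hasMFDerivAt_zero h'.hasMFDerivAt_zero
  have := DFunLike.congr_fun this (1 : ℝ)
  exact ((one_smul ℝ X).symm.trans this).trans (one_smul ℝ Y)

/-- A one-parameter subgroup with zero velocity is constant. -/
theorem eq_one [LieGroup 𝓘(ℝ, E) ∞ G] (h : IsOneParam φ (0 : GroupLieAlgebra 𝓘(ℝ, E) G)) (s : ℝ) :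
    φ s = 1 := by
  have hz : ∀ u, HasMFDerivAt 𝓘(ℝ, ℝ) 𝓘(ℝ, E) φ u 0 := by
    intro u
    have h1 : HasMFDerivAt 𝓘(ℝ, ℝ) 𝓘(ℝ, ℝ) (fun s : ℝ => s - u) u
        (ContinuousLinearMap.id ℝ ℝ) := by
      apply HasFDerivAt.hasMFDerivAt
      exact (hasFDerivAt_id u).sub_const u
    have h2 : HasMFDerivAt 𝓘(ℝ, ℝ) 𝓘(ℝ, E) φ (u - u) 0 := by
      rw [sub_self]
      exact h.hasMFDerivAt_zero.congr_mfderiv (ContinuousLinearMap.toSpanSingleton_zero ℝ)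
    have h3 := h2.comp (f := fun s : ℝ => s - u) u h1
    have h4 : MDifferentiableAt 𝓘(ℝ, E) 𝓘(ℝ, E) (fun k : G => φ u * k) (φ (u - u)) :=
      ((contMDiff_mul_left (I := 𝓘(ℝ, E)) (n := ∞) (a := φ u)).mdifferentiable (by simp)) _
    have h5 := h4.hasMFDerivAt.comp u h3
    have e : ((fun k : G => φ u * k) ∘ (φ ∘ fun s => s - u)) = φ := by
      funext s
      simp [← h.map_add]
    rw [e] at h5
    refine h5.congr_mfderiv (ContinuousLinearMap.ext fun v => ?_)
    exact _root_.map_zero (mfderiv 𝓘(ℝ, E) 𝓘(ℝ, E) (fun k : G => φ u * k) (φ (u - u)))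
  have hcont : Continuous φ := continuous_iff_continuousAt.2 fun u => (hz u).continuousAt
  have hloc : IsLocallyConstant φ := by
    rw [IsLocallyConstant.iff_eventually_eq]
    intro u
    have hs : ∀ᶠ v in 𝓝 u, φ v ∈ (chartAt E (φ u)).source :=
      hcont.continuousAt ((chartAt E (φ u)).open_source.mem_nhds (mem_chart_source E (φ u)))
    obtain ⟨ε, hε, hb⟩ := Metric.eventually_nhds_iff_ball.1 hs
    have hder : ∀ v ∈ Metric.ball u ε, HasFDerivAt (fun s => chartAt E (φ u) (φ s))
        (0 : ℝ →L[ℝ] E) v := by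
      intro v hv
      have hc : MDifferentiableAt 𝓘(ℝ, E) 𝓘(ℝ, E) (chartAt E (φ u)) (φ v) :=
        (contMDiffAt_of_mem_maximalAtlas (n := 1) (IsManifold.chart_mem_maximalAtlas _)
          (hb v hv)).mdifferentiableAt (by simp)
      have := (hc.hasMFDerivAt.comp v (hz v)).hasFDerivAt
      refine this.congr_fderiv (ContinuousLinearMap.ext fun w => ?_)
      exact _root_.map_zero (mfderiv 𝓘(ℝ, E) 𝓘(ℝ, E) (chartAt E (φ u)) (φ v))
    filter_upwards [Metric.ball_mem_nhds u hε] with v hv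
    have := (convex_ball u ε).is_const_of_fderivWithin_eq_zero (𝕜 := ℝ)
      (f := fun s => chartAt E (φ u) (φ s))
      (fun w hw => (hder w hw).differentiableAt.differentiableWithinAt)
      (fun w hw => by
        rw [fderivWithin_of_isOpen Metric.isOpen_ball hw]; exact (hder w hw).fderiv)
      hv (Metric.mem_ball_self hε)
    exact (chartAt E (φ u)).injOn (hb v hv) (mem_chart_source E (φ u)) this
  rw [hloc.apply_eq_of_isPreconnected isPreconnected_univ (Set.mem_univ s) (Set.mem_univ 0),
    h.map_zero]

theorem unique [LieGroup 𝓘(ℝ, E) ∞ G] (h : IsOneParam φ X) (h' : IsOneParam ψ X)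
    (hc : ∀ s u, Commute (φ s) (ψ u)) : φ = ψ := by
  have hn := h'.smul (-1)
  have hm := h.mul hn (fun s u => hc _ _)
  have e : X + (-1 : ℝ) • X = 0 := by rw [neg_one_smul, add_neg_cancel]
  rw [e] at hm
  funext s
  have h1 := hm.eq_one s
  have h2 := h'.map_add s (-1 * s)
  have h3 : s + -1 * s = 0 := by ring
  rw [h3, h'.map_zero] at h2
  exact (eq_inv_of_mul_eq_one_left h1).trans (eq_inv_of_mul_eq_one_left h2.symm).symm

end IsOneParam

/-- Closed connected commutative subgroups; in a compact Lie group these are the tori. -/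
def IsTorus {G : Type*} [TopologicalSpace G] [Group G] (T : Subgroup G) : Prop :=
  IsClosed (T : Set G) ∧ IsConnected (T : Set G) ∧ ∀ a ∈ T, ∀ b ∈ T, a * b = b * a

/-- A maximal torus of `G`. -/
structure MaximalTorus (G : Type*) [TopologicalSpace G] [Group G] where
  sub : Subgroup G
  maximal : Maximal IsTorus sub

namespace MaximalTorus

section Weyl

variable {G : Type*} [TopologicalSpace G] [Group G] (T : MaximalTorus G)

theorem comm {a b : G} (ha : a ∈ T.sub) (hb : b ∈ T.sub) : a * b = b * a :=
  T.maximal.prop.2.2 a ha b hb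

/-- The Weyl group `W = N_G(T) / T`. -/
def Weyl : Type _ :=
  Subgroup.normalizer (T.sub : Set G) ⧸ T.sub.subgroupOf (Subgroup.normalizer (T.sub : Set G))

instance : Group T.Weyl :=
  inferInstanceAs (Group (Subgroup.normalizer (T.sub : Set G) ⧸
    T.sub.subgroupOf (Subgroup.normalizer (T.sub : Set G))))

/-- `W` acts on `T` by conjugation. -/
def weylOnTorus : T.Weyl →* MulAut T.sub :=
  QuotientGroup.lift (T.sub.subgroupOf (Subgroup.normalizer (T.sub : Set G)))
    T.sub.normalizerMonoidHom (by
      intro n hn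
      ext a
      change (n : G) * a * (n : G)⁻¹ = a
      rw [show (n : G) * a = a * n from T.comm hn a.2, mul_inv_cancel_right])

instance : MulAction T.Weyl T.sub := MulAction.compHom T.sub T.weylOnTorus

end Weyl

variable (E)
variable [LieGroup 𝓘(ℝ, E) ∞ G] (T : MaximalTorus G)

/-- The Lie algebra `𝔱` of `T`, as a subspace of the Lie algebra of `G`: the velocities of the
one-parameter subgroups of `T`. -/
def lieAlgebra : Submodule ℝ (GroupLieAlgebra 𝓘(ℝ, E) G) where
  carrier := {X | ∃ φ : ℝ → G, (∀ s, φ s ∈ T.sub) ∧ IsOneParam φ X}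
  zero_mem' := ⟨fun _ => 1, fun _ => T.sub.one_mem, IsOneParam.const⟩
  add_mem' := by
    rintro X Y ⟨φ, hφ, hX⟩ ⟨ψ, hψ, hY⟩
    exact ⟨fun s => φ s * ψ s, fun s => T.sub.mul_mem (hφ s) (hψ s),
      hX.mul hY fun s u => T.comm (hφ s) (hψ u)⟩
  smul_mem' := by
    rintro c X ⟨φ, hφ, hX⟩
    exact ⟨fun s => φ (c * s), fun s => hφ _, hX.smul c⟩

/-- `exp X = φ 1`, where `φ` is the one-parameter subgroup of `T` with velocity `X`; it is unique,
see `expFun_eq`. -/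
def expFun (X : T.lieAlgebra E) : T.sub :=
  ⟨X.2.choose 1, X.2.choose_spec.1 1⟩

variable {E}

theorem expFun_eq (X : T.lieAlgebra E) {φ : ℝ → G} (hφ : ∀ s, φ s ∈ T.sub)
    (h : IsOneParam φ (X : GroupLieAlgebra 𝓘(ℝ, E) G)) : (T.expFun E X : G) = φ 1 :=
  congrFun (X.2.choose_spec.2.unique h fun s u => T.comm (X.2.choose_spec.1 s) (hφ u)) 1

variable (E)

/-- The exponential map `exp : 𝔱 → T`, a homomorphism since `T` is commutative. -/
def exp : T.lieAlgebra E →+ Additive T.sub where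
  toFun X := Additive.ofMul (T.expFun E X)
  map_zero' := by
    refine congrArg Additive.ofMul (Subtype.ext ?_)
    exact T.expFun_eq 0 (fun _ => T.sub.one_mem) IsOneParam.const
  map_add' X Y := by
    refine congrArg Additive.ofMul (Subtype.ext ?_)
    obtain ⟨φ, hφ, hX⟩ := X.2
    obtain ⟨ψ, hψ, hY⟩ := Y.2
    refine Eq.trans ?_ (congrArg₂ (· * ·) (T.expFun_eq X hφ hX) (T.expFun_eq Y hψ hY)).symm
    exact T.expFun_eq (X + Y) (fun s => T.sub.mul_mem (hφ s) (hψ s))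
      (hX.mul hY fun s u => T.comm (hφ s) (hψ u))

/-- `Γ(T)`, the kernel of `exp : 𝔱 → T`. -/
def lattice : AddSubgroup (T.lieAlgebra E) := (T.exp E).ker

/-- The action of `N_G(T)` on `𝔱` through `Ad`. -/
def normalizerOnLie : Subgroup.normalizer (T.sub : Set G) →* Module.End ℝ (T.lieAlgebra E) where
  toFun n := (Ad E (n : G)).toLinearMap.restrict (p := T.lieAlgebra E) (q := T.lieAlgebra E) (by
    rintro X ⟨φ, hφ, hX⟩
    exact ⟨_, fun s => (Subgroup.mem_normalizer_iff.1 n.2 _).1 (hφ s), hX.conj n⟩)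
  map_one' := by
    ext X
    exact congrArg (fun f => f (X : GroupLieAlgebra 𝓘(ℝ, E) G)) (Ad_one (E := E) (G := G))
  map_mul' n m := by
    ext X
    exact congrArg (fun f => f (X : GroupLieAlgebra 𝓘(ℝ, E) G)) (Ad_mul (E := E) (n : G) (m : G))

/-- The induced action of `W` on `𝔱`. -/
def weylOnLie : T.Weyl →* Module.End ℝ (T.lieAlgebra E) :=
  QuotientGroup.lift (T.sub.subgroupOf (Subgroup.normalizer (T.sub : Set G)))
    (T.normalizerOnLie E) (by
      intro n hn
      ext X
      obtain ⟨φ, hφ, hX⟩ := X.2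
      have h := hX.conj (n : G)
      have e : (fun s => (n : G) * φ s * (n : G)⁻¹) = φ := by
        funext s
        rw [show (n : G) * φ s = φ s * n from T.comm hn (hφ s), mul_inv_cancel_right]
      rw [e] at h
      exact h.velocity_unique hX)

instance : DistribMulAction T.Weyl (T.lieAlgebra E) :=
  DistribMulAction.compHom (T.lieAlgebra E) (T.weylOnLie E)

theorem exp_smul (w : T.Weyl) (X : T.lieAlgebra E) :
    (T.exp E (w • X)).toMul = w • (T.exp E X).toMul := by
  obtain ⟨n, rfl⟩ := QuotientGroup.mk_surjective w
  obtain ⟨φ, hφ, hX⟩ := X.2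
  refine Subtype.ext ?_
  refine (T.expFun_eq _ (fun s => (Subgroup.mem_normalizer_iff.1 n.2 _).1 (hφ s))
    (hX.conj (n : G))).trans ?_
  refine (congrArg (fun a => (n : G) * a * (n : G)⁻¹) (T.expFun_eq X hφ hX)).symm

theorem smul_mem_lattice (w : T.Weyl) {X : T.lieAlgebra E} (hX : X ∈ T.lattice E) :
    w • X ∈ T.lattice E := by
  have h1 : T.exp E X = 0 := hX
  have h2 := T.exp_smul E w X
  rw [h1] at h2
  refine (congrArg Additive.ofMul h2).trans ?_
  exact congrArg Additive.ofMul ((T.weylOnTorus w).map_one)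

instance : DistribMulAction T.Weyl (T.lattice E) where
  smul w γ := ⟨w • (γ : T.lieAlgebra E), T.smul_mem_lattice E w γ.2⟩
  one_smul γ := Subtype.ext (one_smul T.Weyl (γ : T.lieAlgebra E))
  mul_smul w v γ := Subtype.ext (mul_smul w v (γ : T.lieAlgebra E))
  smul_zero w := Subtype.ext (smul_zero (A := T.lieAlgebra E) w)
  smul_add w γ δ := Subtype.ext (smul_add w (γ : T.lieAlgebra E) (δ : T.lieAlgebra E))

/-- The action of `W` on `Γ(T)` by automorphisms. -/
def weylOnLattice : T.Weyl →* MulAut (Multiplicative (T.lattice E)) :=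
  (MulAutMultiplicative (T.lattice E)).symm.toMonoidHom.comp
    (DistribMulAction.toAddAut T.Weyl (T.lattice E))

/-- The extended affine Weyl group `Γ(T) ⋊ W`. -/
abbrev ExtAffineWeyl : Type _ := Multiplicative (T.lattice E) ⋊[T.weylOnLattice E] T.Weyl

/-- `Γ(T) ⋊ W` acts on `𝔱` by affine maps: `(γ, w) • x = γ + w x`. -/
instance : MulAction (T.ExtAffineWeyl E) (T.lieAlgebra E) where
  smul g x := ((g.left.toAdd : T.lattice E) : T.lieAlgebra E) + g.right • x
  one_smul x := by
    change ((0 : T.lattice E) : T.lieAlgebra E) + (1 : T.Weyl) • x = x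
    rw [one_smul]; simp
  mul_smul g h x := by
    change ((g.left.toAdd : T.lattice E) : T.lieAlgebra E) +
        g.right • ((h.left.toAdd : T.lattice E) : T.lieAlgebra E) + (g.right * h.right) • x =
      ((g.left.toAdd : T.lattice E) : T.lieAlgebra E) +
        g.right • (((h.left.toAdd : T.lattice E) : T.lieAlgebra E) + h.right • x)
    rw [smul_add, mul_smul, add_assoc]

open TensorProduct in
/-- The (real, infinitesimal) roots: the nonzero linear forms `α : 𝔱 → ℝ` such that
`exp X ↦ e ^ (2 π i α(X))` is a weight of `T` in the complexified adjoint representation. -/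
def IsRoot (α : Module.Dual ℝ (T.lieAlgebra E)) : Prop :=
  α ≠ 0 ∧ ∃ Z : ℂ ⊗[ℝ] GroupLieAlgebra 𝓘(ℝ, E) G, Z ≠ 0 ∧ ∀ X : T.lieAlgebra E,
    (Ad E ((T.exp E X).toMul : G)).toLinearMap.baseChange ℂ Z =
      Complex.exp (2 * Real.pi * Complex.I * (α X : ℂ)) • Z

/-- The hyperplane `α = k`. -/
def singularHyperplane (α : Module.Dual ℝ (T.lieAlgebra E)) (k : ℤ) : Set (T.lieAlgebra E) :=
  {x | α x = k}

/-- `𝔱_r`: the complement of the union of the singular hyperplanes. -/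
def regularSet : Set (T.lieAlgebra E) :=
  (⋃ α ∈ {α | T.IsRoot E α}, ⋃ k : ℤ, T.singularHyperplane E α k)ᶜ

/-- The alcoves are the connected components of `𝔱_r`. -/
def IsAlcove (A : Set (T.lieAlgebra E)) : Prop :=
  ∃ x ∈ T.regularSet E, A = connectedComponentIn (T.regularSet E) x

/-- The vertices of the polytope `closure A`, i.e. its extreme points. -/
def vertices (A : Set (T.lieAlgebra E)) : Set (T.lieAlgebra E) :=
  (closure A).extremePoints ℝ

/-- The barycentre of `A`: all vertices of `closure A` with equal weights. -/
def barycentre (A : Set (T.lieAlgebra E)) : T.lieAlgebra E :=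
  ((T.vertices E A).ncard : ℝ)⁻¹ • ∑ᶠ v ∈ T.vertices E A, v

end MaximalTorus

end AlcoveLie

end

open AlcoveLie

/-! Both groups are identified with the stabilizer of `x₀` in `Γ(T) ⋊ W`. For any `x ∈ 𝔱`,
equivariance of `exp` shows that `w` fixes `exp x` exactly when `x - w x ∈ Γ(T)`, and then `x - w x`
is the only translation part that makes `γ w` fix `x`. So projection to `W` is an isomorphism from
the stabilizer of `x` onto that of `exp x` (`stabilizerEquiv`).

It remains to see that `x₀` and `A` have the same stabilizer (`IsAlcove.stabilizer_barycentre`). The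
Weyl group permutes the roots and roots are integral on `Γ(T)`, so `Γ(T) ⋊ W` permutes the alcoves.
If `g` fixes `x₀ ∈ A`, it fixes the component containing `x₀`. Conversely an affine bijection
preserving `A` permutes the vertices of its closure and so fixes their mean.

This needs `closure A` to be a compact polytope with finitely many vertices whose mean is interior.
An alcove is an open cell `k α < α x < k α + 1`; there are finitely many roots (`finite_roots`), and
trivial centre makes them separate points (`exists_root`). Indeed, `Ad ∘ exp` is a bounded
representation of `𝔱`, hence a sum of unitary characters after complexification. If all roots vanish
at `X`, then `exp (s X)` acts trivially on the Lie algebra, is central, hence trivial, and `X = 0`.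
-/

noncomputable section

namespace AlcoveLie

/-! ### The kernel and the differentiability of the adjoint representation. -/

section AdjointRepresentation

/-- A self-map of a connected manifold with vanishing derivative is constant. -/
theorem eq_of_hasMFDerivAt_zero {E : Type*} [NormedAddCommGroup E] [NormedSpace ℝ E]
    {M : Type*} [TopologicalSpace M] [ChartedSpace E M] [IsManifold 𝓘(ℝ, E) 1 M]
    [PreconnectedSpace M] {f : M → M}
    (hf : ∀ x, HasMFDerivAt 𝓘(ℝ, E) 𝓘(ℝ, E) f x (0 : E →L[ℝ] E)) (x y : M) : f x = f y := by
  have hloc : IsLocallyConstant f := by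
    rw [IsLocallyConstant.iff_eventually_eq]
    intro u
    set e := chartAt E u with he
    set c := chartAt E (f u) with hc
    have hu : u ∈ e.source := mem_chart_source E u
    have hs : ∀ᶠ v in 𝓝 (e u), v ∈ e.target ∧ f (e.symm v) ∈ c.source := by
      have h1 : ContinuousAt (fun v => f (e.symm v)) (e u) := by
        refine ContinuousAt.comp (g := f) ?_ (e.continuousAt_symm (e.map_source hu))
        exact (hf _).continuousAt
      have h2 : c.source ∈ 𝓝 (f (e.symm (e u))) := by
        rw [e.left_inv hu]; exact c.open_source.mem_nhds (mem_chart_source E (f u))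
      exact Filter.Eventually.and (e.open_target.mem_nhds (e.map_source hu)) (h1 h2)
    obtain ⟨ε, hε, hb⟩ := Metric.eventually_nhds_iff_ball.1 hs
    have hder : ∀ v ∈ Metric.ball (e u) ε, HasFDerivAt (fun s => c (f (e.symm s)))
        (0 : E →L[ℝ] E) v := by
      intro v hv
      have h1 : MDifferentiableAt 𝓘(ℝ, E) 𝓘(ℝ, E) e.symm v :=
        (contMDiffOn_chart_symm (I := 𝓘(ℝ, E)) (n := 1) (x := u)).mdifferentiableOn (by simp) v
          (hb v hv).1 |>.mdifferentiableAt (e.open_target.mem_nhds (hb v hv).1)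
      have h2 : MDifferentiableAt 𝓘(ℝ, E) 𝓘(ℝ, E) c (f (e.symm v)) :=
        (contMDiffAt_of_mem_maximalAtlas (n := 1) (IsManifold.chart_mem_maximalAtlas _)
          (hb v hv).2).mdifferentiableAt (by simp)
      have h3 := (h2.hasMFDerivAt.comp v ((hf _).comp v h1.hasMFDerivAt)).hasFDerivAt
      refine h3.congr_fderiv (ContinuousLinearMap.ext fun w => ?_)
      exact map_zero (mfderiv 𝓘(ℝ, E) 𝓘(ℝ, E) c (f (e.symm v)))
    have hev : ∀ᶠ z in 𝓝 u, e z ∈ Metric.ball (e u) ε :=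
      (e.continuousAt hu) (Metric.ball_mem_nhds _ hε)
    filter_upwards [hev, e.open_source.mem_nhds hu] with z hz hz'
    have := (convex_ball (e u) ε).is_const_of_fderivWithin_eq_zero (𝕜 := ℝ)
      (f := fun s => c (f (e.symm s)))
      (fun w hw => (hder w hw).differentiableAt.differentiableWithinAt)
      (fun w hw => by
        rw [fderivWithin_of_isOpen Metric.isOpen_ball hw]; exact (hder w hw).fderiv)
      hz (Metric.mem_ball_self hε)
    have h4 := (hb _ hz).2
    simp only [e.left_inv hz', e.left_inv hu] at this h4
    exact c.injOn h4 (mem_chart_source E (f u)) this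
  exact hloc.apply_eq_of_isPreconnected isPreconnected_univ (Set.mem_univ x) (Set.mem_univ y)

variable {E : Type*} [NormedAddCommGroup E] [NormedSpace ℝ E]
  {G : Type*} [TopologicalSpace G] [ChartedSpace E G] [Group G] [LieGroup 𝓘(ℝ, E) ∞ G]

/-- In a connected Lie group, an element acting trivially on the Lie algebra is central. -/
theorem mem_center_of_Ad_eq_id [PreconnectedSpace G] {g : G}
    (hg : Ad E g = ContinuousLinearMap.id ℝ _) : g ∈ Subgroup.center G := by
  have hman : IsManifold 𝓘(ℝ, E) 1 G := IsManifold.of_le (n := ∞) (by simp)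
  -- The commutator map `K k = g k g⁻¹ k⁻¹` satisfies `K k * k = g k g⁻¹`; differentiating at `1`
  -- gives `dK + id = Ad g = id`, so `dK = 0`.
  have hK : MDifferentiableAt 𝓘(ℝ, E) 𝓘(ℝ, E) (fun k : G => g * k * g⁻¹ * k⁻¹) 1 := by
    have : ContMDiff 𝓘(ℝ, E) 𝓘(ℝ, E) ∞ (fun k : G => g * k * g⁻¹ * k⁻¹) :=
      ((contMDiff_const.mul contMDiff_id).mul contMDiff_const).mul contMDiff_id.inv
    exact this.mdifferentiable (by simp) _
  have hK0 : mfderiv 𝓘(ℝ, E) 𝓘(ℝ, E) (fun k : G => g * k * g⁻¹ * k⁻¹) 1 = (0 : E →L[ℝ] E) := by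
    have h1 := (hasMFDerivAt_mul_of_eq_one (E := E) (a := g * 1 * g⁻¹ * 1⁻¹) (b := (1 : G))
      (by simp) rfl).comp (f := fun k : G => (g * k * g⁻¹ * k⁻¹, id k)) (1 : G) (hK.hasMFDerivAt.prodMk (hasMFDerivAt_id (1 : G)))
    have e : ((fun p : G × G => p.1 * p.2) ∘ fun k : G => (g * k * g⁻¹ * k⁻¹, id k)) =
        fun k => g * k * g⁻¹ := by funext k; simp
    have h2 := hasMFDerivAt_Ad (E := E) g (a := 1) rfl
    rw [hg] at h2
    have h3 := hasMFDerivAt_unique (e ▸ h1) h2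
    refine ContinuousLinearMap.ext fun v => ?_
    exact (add_eq_right (M := E)).1 (DFunLike.congr_fun h3 v)
  -- The derivative vanishes at every `h` because `K k = (g h g⁻¹) * K (h⁻¹ k) * h⁻¹`, which moves
  -- the base point to `1`.
  have hF : ∀ h : G, HasMFDerivAt 𝓘(ℝ, E) 𝓘(ℝ, E) (fun k : G => g * k * g⁻¹ * k⁻¹) h
      (0 : E →L[ℝ] E) := by
    intro h
    have h1 : MDifferentiableAt 𝓘(ℝ, E) 𝓘(ℝ, E) (fun k : G => h⁻¹ * k) h :=
      ((contMDiff_mul_left (I := 𝓘(ℝ, E)) (n := ∞) (a := h⁻¹)).mdifferentiable (by simp)) _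
    have h2 : HasMFDerivAt 𝓘(ℝ, E) 𝓘(ℝ, E) (fun k : G => g * k * g⁻¹ * k⁻¹) (h⁻¹ * h)
        (0 : E →L[ℝ] E) := by
      rw [inv_mul_cancel, ← hK0]; exact hK.hasMFDerivAt
    have h3 : MDifferentiable 𝓘(ℝ, E) 𝓘(ℝ, E) (fun k : G => g * h * g⁻¹ * k * h⁻¹) := by
      have : ContMDiff 𝓘(ℝ, E) 𝓘(ℝ, E) ∞ (fun k : G => g * h * g⁻¹ * k * h⁻¹) :=
        (contMDiff_const.mul contMDiff_id).mul contMDiff_const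
      exact this.mdifferentiable (by simp)
    have h4 := (h3 _).hasMFDerivAt.comp h (h2.comp h h1.hasMFDerivAt)
    have e : ((fun k : G => g * h * g⁻¹ * k * h⁻¹) ∘ (fun k : G => g * k * g⁻¹ * k⁻¹) ∘
        fun k => h⁻¹ * k) = fun k : G => g * k * g⁻¹ * k⁻¹ := by
      funext k; simp [mul_assoc]
    rw [e] at h4
    refine h4.congr_mfderiv (ContinuousLinearMap.ext fun w => ?_)
    exact map_zero (mfderiv 𝓘(ℝ, E) 𝓘(ℝ, E) (fun k : G => g * h * g⁻¹ * k * h⁻¹) _)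
  rw [Subgroup.mem_center_iff]
  intro h
  have h1 := eq_of_hasMFDerivAt_zero hF h 1
  have h2 : g * h * g⁻¹ * h⁻¹ = 1 := by simpa using h1
  rw [mul_inv_eq_one, mul_inv_eq_iff_eq_mul] at h2
  exact h2.symm

variable (E) in
/-- The adjoint representation, with values in the endomorphisms of the model space `E`. -/
def adModel (g : G) : E →L[ℝ] E := Ad E g

/-- The adjoint representation is continuously differentiable. -/
theorem contMDiff_adModel :
    ContMDiff 𝓘(ℝ, E) 𝓘(ℝ, E →L[ℝ] E) 1 (adModel E : G → E →L[ℝ] E) := by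
  have hman : IsManifold 𝓘(ℝ, E) 1 G := IsManifold.of_le (n := ∞) (by simp)
  intro g₀
  have h1 : ContMDiffAt (𝓘(ℝ, E).prod 𝓘(ℝ, E)) 𝓘(ℝ, E) ∞
      (Function.uncurry fun g h : G => g * h * g⁻¹) (g₀, 1) := by
    have : ContMDiff (𝓘(ℝ, E).prod 𝓘(ℝ, E)) 𝓘(ℝ, E) ∞ (fun p : G × G => p.1 * p.2 * p.1⁻¹) :=
      (contMDiff_fst.mul contMDiff_snd).mul contMDiff_fst.inv
    exact this _
  have h2 := h1.mfderiv (m := 1) (fun g h : G => g * h * g⁻¹) (fun _ => 1) contMDiffAt_const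
    (by norm_cast)
  -- Every conjugate of `1` is `1`, so the tangent coordinate changes are all trivial and the smooth
  -- family of derivatives is `Ad` itself.
  have hcc : ∀ (a b : G) (v : E), a = 1 → b = 1 →
      (tangentBundleCore 𝓘(ℝ, E) G).coordChange (achart E a) (achart E b) a v = v := by
    rintro a b v rfl rfl
    exact (tangentBundleCore 𝓘(ℝ, E) G).coordChange_self _ _ (mem_chart_source E _) v
  refine h2.congr_of_eventuallyEq (Filter.Eventually.of_forall fun g => ?_)
  refine Eq.trans ?_ (inTangentCoordinates_eq (I := 𝓘(ℝ, E)) (I' := 𝓘(ℝ, E))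
    (fun _ : G => (1 : G)) (fun x : G => x * 1 * x⁻¹) (fun x => Ad E x) (x₀ := g₀) (x := g)
    (mem_chart_source E _) (by simp)).symm
  refine ContinuousLinearMap.ext fun v => ?_
  refine Eq.trans ?_ (hcc _ _ _ (by simp) (by simp)).symm
  exact (congrArg (Ad E g) (hcc _ _ v rfl rfl)).symm

variable (E G) in
/-- The derivative at `1` of the adjoint representation. -/
def adModelDeriv : E →L[ℝ] (E →L[ℝ] E) :=
  mfderiv 𝓘(ℝ, E) 𝓘(ℝ, E →L[ℝ] E) (adModel E : G → E →L[ℝ] E) 1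

/-- The derivative depends on `φ` only through `X`, and linearly, which is what makes `adGenerator`
a linear map. -/
theorem IsOneParam.hasDerivAt_adModel {φ : ℝ → G} {X : GroupLieAlgebra 𝓘(ℝ, E) G}
    (h : IsOneParam φ X) : HasDerivAt (fun s => adModel E (φ s)) (adModelDeriv E G X) 0 := by
  have h1 : HasMFDerivAt 𝓘(ℝ, E) 𝓘(ℝ, E →L[ℝ] E) (adModel E : G → E →L[ℝ] E) (φ 0)
      (adModelDeriv E G) := by
    rw [h.map_zero]
    exact (contMDiff_adModel.mdifferentiable (by simp) (1 : G)).hasMFDerivAt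
  have h2 : HasFDerivAt (fun s => adModel E (φ s))
      ((adModelDeriv E G).comp (ContinuousLinearMap.toSpanSingleton ℝ (X : E))) 0 :=
    (h1.comp (0 : ℝ) h.hasMFDerivAt_zero).hasFDerivAt
  refine h2.hasDerivAt.congr_deriv ?_
  exact congrArg (adModelDeriv E G) (one_smul ℝ (X : E))

end AdjointRepresentation

/-! ### Weights of bounded representations of a real vector space. -/

section Weights

open TensorProduct

section BoundedRep

/-- A bounded representation `P` of the additive group of a real vector space `𝔱` that is
differentiable along lines, with infinitesimal generators `D`. -/
structure IsBoundedRep {𝔱 F : Type*} [AddCommGroup 𝔱] [Module ℝ 𝔱]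
    [NormedAddCommGroup F] [NormedSpace ℝ F]
    (P : 𝔱 → F →L[ℝ] F) (D : 𝔱 →ₗ[ℝ] (F →L[ℝ] F)) : Prop where
  map_zero : P 0 = 1
  map_add : ∀ X Y, P (X + Y) = P X * P Y
  hasDerivAt_zero : ∀ X, HasDerivAt (fun s : ℝ => P (s • X)) (D X) 0
  bounded : ∃ C, ∀ X, ‖P X‖ ≤ C

namespace IsBoundedRep

variable {𝔱 F : Type*} [AddCommGroup 𝔱] [Module ℝ 𝔱] [NormedAddCommGroup F] [NormedSpace ℝ F]
  {P : 𝔱 → F →L[ℝ] F} {D : 𝔱 →ₗ[ℝ] (F →L[ℝ] F)}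

theorem hasDerivAt (h : IsBoundedRep P D) (X : 𝔱) (s : ℝ) :
    HasDerivAt (fun s : ℝ => P (s • X)) (P (s • X) * D X) s := by
  have h1 : HasDerivAt (fun u : ℝ => P ((u - s) • X)) (D X) s := by
    have h0 : HasDerivAt (fun u : ℝ => P (u • X)) (D X) (s - s) := by
      rw [sub_self]; exact h.hasDerivAt_zero X
    simpa using HasDerivAt.comp_sub_const s s h0
  have h2 := h1.const_mul (P (s • X))
  refine h2.congr_of_eventuallyEq (Filter.Eventually.of_forall fun u => ?_)
  simp only
  rw [← h.map_add, ← add_smul, add_sub_cancel]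

theorem commute (h : IsBoundedRep P D) (X Y : 𝔱) : P X * P Y = P Y * P X := by
  rw [← h.map_add, ← h.map_add, add_comm]

/-- Differentiate `P X * P Y = P Y * P X` in one variable at a time. -/
theorem commute_generator (h : IsBoundedRep P D) (X Y : 𝔱) : D X * D Y = D Y * D X := by
  have h1 : ∀ X Y, D X * P Y = P Y * D X := by
    intro X Y
    refine ((h.hasDerivAt_zero X).mul_const (P Y)).unique ?_
    refine ((h.hasDerivAt_zero X).const_mul (P Y)).congr_of_eventuallyEq
      (Filter.Eventually.of_forall fun u => h.commute _ _)
  refine ((h.hasDerivAt_zero Y).const_mul (D X)).unique ?_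
  exact ((h.hasDerivAt_zero Y).mul_const (D X)).congr_of_eventuallyEq
    (Filter.Eventually.of_forall fun u => h1 _ _)

/-- Complexification of an endomorphism. -/
abbrev cx (f : F →L[ℝ] F) : Module.End ℂ (ℂ ⊗[ℝ] F) := f.toLinearMap.baseChange ℂ

theorem cx_mul (f g : F →L[ℝ] F) : cx (f * g) = cx f * cx g :=
  LinearMap.baseChange_comp _ _

theorem cx_one : cx (1 : F →L[ℝ] F) = 1 := LinearMap.baseChange_id

theorem cx_injective : Function.Injective (cx : (F →L[ℝ] F) → _) := by
  intro f g hfg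
  ext v
  have h1 : (1 : ℂ) ⊗ₜ[ℝ] f v = 1 ⊗ₜ g v := by
    simpa using DFunLike.congr_fun hfg (1 ⊗ₜ v)
  exact Module.FaithfullyFlat.tensorProduct_mk_injective (A := ℝ) (B := ℂ) F h1

variable [FiniteDimensional ℝ F]

/-- Matrix coefficients of the complexification. -/
def coeff (ℓ : Module.Dual ℂ (ℂ ⊗[ℝ] F)) (v : ℂ ⊗[ℝ] F) : (F →L[ℝ] F) →L[ℝ] ℂ :=
  LinearMap.toContinuousLinearMap
    { toFun := fun f => ℓ (cx f v)
      map_add' := fun f g => by simp [cx, LinearMap.baseChange_add]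
      map_smul' := fun c f => by
        simp [cx, LinearMap.baseChange_smul] }

theorem coeff_apply (ℓ : Module.Dual ℂ (ℂ ⊗[ℝ] F)) (v : ℂ ⊗[ℝ] F) (f : F →L[ℝ] F) :
    coeff ℓ v f = ℓ (cx f v) := rfl

theorem coeff_bounded (h : IsBoundedRep P D) (ℓ : Module.Dual ℂ (ℂ ⊗[ℝ] F)) (v : ℂ ⊗[ℝ] F) :
    ∃ C, ∀ X, ‖ℓ (cx (P X) v)‖ ≤ C := by
  obtain ⟨C, hC⟩ := h.bounded
  refine ⟨‖coeff ℓ v‖ * C, fun X => ?_⟩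
  rw [← coeff_apply]
  exact (coeff ℓ v).le_opNorm_of_le (hC X)

theorem hasDerivAt_coeff (h : IsBoundedRep P D) (ℓ : Module.Dual ℂ (ℂ ⊗[ℝ] F)) (v : ℂ ⊗[ℝ] F)
    (X : 𝔱) (s : ℝ) :
    HasDerivAt (fun s : ℝ => ℓ (cx (P (s • X)) v)) (ℓ (cx (P (s • X)) (cx (D X) v))) s := by
  have := (coeff ℓ v).hasFDerivAt.comp_hasDerivAt s (h.hasDerivAt X s)
  rw [coeff_apply, cx_mul] at this
  exact this

/-- Exponential of a Jordan chain of length two. Tested against `ℓ`, the function `e^(-sμ) ℓ(P(sX)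
v) - s ℓ(u)` has zero derivative, hence equals its value `ℓ v` at `0`. The case `u = 0` treats
eigenvectors. -/
theorem apply_of_jordan (h : IsBoundedRep P D) {X : 𝔱} {μ : ℂ} {u v : ℂ ⊗[ℝ] F}
    (hv : cx (D X) v = μ • v + u)
    (hu : ∀ s : ℝ, cx (P (s • X)) u = Complex.exp (s * μ) • u) (s : ℝ) :
    cx (P (s • X)) v = Complex.exp (s * μ) • (v + (s : ℂ) • u) := by
  suffices H : ∀ ℓ : Module.Dual ℂ (ℂ ⊗[ℝ] F),
      Complex.exp (-(s * μ)) * ℓ (cx (P (s • X)) v) - s * ℓ u = ℓ v by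
    rw [← sub_eq_zero, ← Module.forall_dual_apply_eq_zero_iff ℂ]
    intro ℓ
    have h1 := H ℓ
    have h2 : Complex.exp (s * μ) * Complex.exp (-(s * μ)) = 1 := by
      rw [← Complex.exp_add]; simp
    simp only [map_sub, map_smul, _root_.map_add, smul_eq_mul]
    linear_combination Complex.exp (s * μ) * h1 - ℓ (cx (P (s • X)) v) * h2
  intro ℓ
  have hd : ∀ s : ℝ, HasDerivAt (fun s : ℝ => Complex.exp (-(s * μ)) * ℓ (cx (P (s • X)) v)
      - s * ℓ u) 0 s := by
    intro s
    have e1 : HasDerivAt (fun s : ℝ => Complex.exp (-(s * μ)))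
        (Complex.exp (-(s * μ)) * -(1 * μ)) s :=
      (((hasDerivAt_id s).ofReal_comp.mul_const μ).neg).cexp
    have e2 := (e1.mul (h.hasDerivAt_coeff ℓ v X s)).sub
      ((hasDerivAt_id s).ofReal_comp.mul_const (ℓ u))
    refine e2.congr_deriv ?_
    have h2 : Complex.exp (-(s * μ)) * Complex.exp (s * μ) = 1 := by
      rw [← Complex.exp_add]; simp
    simp only [hv, _root_.map_add, map_smul, hu, smul_eq_mul, Complex.ofReal_one]
    linear_combination ℓ u * h2
  have hc := is_const_of_deriv_eq_zero (fun s => (hd s).differentiableAt)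
    (fun s => (hd s).deriv) s 0
  simpa [h.map_zero, cx_one] using hc

theorem apply_of_eigen (h : IsBoundedRep P D) {X : 𝔱} {μ : ℂ} {v : ℂ ⊗[ℝ] F}
    (hv : cx (D X) v = μ • v) (s : ℝ) :
    cx (P (s • X)) v = Complex.exp (s * μ) • v := by
  simpa using h.apply_of_jordan (u := 0) (by simpa using hv) (by simp) s

/-- Otherwise `e^(sμ)` is unbounded in `s`, against boundedness of the matrix coefficients. -/
theorem re_eigenvalue (h : IsBoundedRep P D) {X : 𝔱} {μ : ℂ} {v : ℂ ⊗[ℝ] F}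
    (hv : cx (D X) v = μ • v) (hv0 : v ≠ 0) : μ.re = 0 := by
  obtain ⟨ℓ, hℓ⟩ : ∃ ℓ : Module.Dual ℂ (ℂ ⊗[ℝ] F), ℓ v ≠ 0 := by
    by_contra! H
    exact hv0 ((Module.forall_dual_apply_eq_zero_iff ℂ v).1 H)
  obtain ⟨C, hC⟩ := h.coeff_bounded ℓ v
  by_contra hre
  have h1 : ∀ s : ℝ, Real.exp (s * μ.re) * ‖ℓ v‖ ≤ C := by
    intro s
    have := hC (s • X)
    rw [h.apply_of_eigen hv s, map_smul, smul_eq_mul, norm_mul, Complex.norm_exp] at this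
    simpa using this
  have hpos : 0 < ‖ℓ v‖ := norm_pos_iff.2 hℓ
  -- This `s` makes the exponent `t = C / ‖ℓ v‖`, giving `e^t ≤ t`, against `t + 1 ≤ e^t`.
  have h2 := h1 (C / ‖ℓ v‖ / μ.re)
  rw [div_mul_cancel₀ _ hre, ← le_div_iff₀ hpos] at h2
  linarith [Real.add_one_le_exp (C / ‖ℓ v‖)]

/-- A nontrivial Jordan block with imaginary eigenvalue would make `‖ℓ(P(sX) v)‖ = ‖ℓ v + s ℓ u‖`
grow linearly. -/
theorem eigen_of_sq (h : IsBoundedRep P D) {X : 𝔱} {μ : ℂ} {u v : ℂ ⊗[ℝ] F}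
    (hv : cx (D X) v = μ • v + u) (hu : cx (D X) u = μ • u) : u = 0 := by
  by_contra hu0
  have hre := h.re_eigenvalue hu hu0
  obtain ⟨ℓ, hℓ⟩ : ∃ ℓ : Module.Dual ℂ (ℂ ⊗[ℝ] F), ℓ u ≠ 0 := by
    by_contra! H
    exact hu0 ((Module.forall_dual_apply_eq_zero_iff ℂ u).1 H)
  obtain ⟨C, hC⟩ := h.coeff_bounded ℓ v
  have hpos : 0 < ‖ℓ u‖ := norm_pos_iff.2 hℓ
  have hC0 : 0 ≤ C := (norm_nonneg _).trans (hC 0)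
  have h1 : ∀ s : ℝ, 0 ≤ s → s * ‖ℓ u‖ ≤ C + ‖ℓ v‖ := by
    intro s hs
    have h2 := hC (s • X)
    rw [h.apply_of_jordan hv (h.apply_of_eigen hu) s, map_smul, smul_eq_mul, norm_mul,
      Complex.norm_exp] at h2
    simp only [Complex.mul_re, Complex.ofReal_re, hre, Complex.ofReal_im, mul_zero, zero_mul,
      sub_zero, Real.exp_zero, one_mul, _root_.map_add, map_smul, smul_eq_mul] at h2
    have h3 := norm_sub_le (ℓ v + s * ℓ u) (ℓ v)
    rw [add_sub_cancel_left, norm_mul, Complex.norm_real, Real.norm_of_nonneg hs] at h3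
    linarith
  have h4 := h1 ((C + ‖ℓ v‖ + 1) / ‖ℓ u‖) (by positivity)
  rw [div_mul_cancel₀ _ hpos.ne'] at h4
  linarith

/-- By `eigen_of_sq`, the square of `D X - μ` kills only what `D X - μ` already kills, so exponents
descend to `1`: the generators are diagonalizable over `ℂ`. -/
theorem eigen_of_mem_maxGenEigenspace (h : IsBoundedRep P D) {X : 𝔱} {μ : ℂ} {v : ℂ ⊗[ℝ] F}
    (hv : v ∈ (cx (D X)).maxGenEigenspace μ) : cx (D X) v = μ • v := by
  rw [Module.End.mem_maxGenEigenspace] at hv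
  obtain ⟨k, hk⟩ := hv
  rw [← sub_eq_zero]
  have key : ∀ w, (cx (D X) - μ • (1 : Module.End ℂ (ℂ ⊗[ℝ] F)))
      ((cx (D X) - μ • (1 : Module.End ℂ (ℂ ⊗[ℝ] F))) w) = 0 → (cx (D X) - μ • (1 : Module.End ℂ (ℂ ⊗[ℝ] F))) w = 0 := by
    intro w hw
    refine h.eigen_of_sq (X := X) (μ := μ) (v := w) (by simp) ?_
    rw [← sub_eq_zero]
    simpa using hw
  have : ∀ k, ((cx (D X) - μ • (1 : Module.End ℂ (ℂ ⊗[ℝ] F))) ^ k) v = 0 →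
      (cx (D X) - μ • (1 : Module.End ℂ (ℂ ⊗[ℝ] F))) v = 0 := by
    intro k
    induction k with
    | zero => intro h0; simp only [pow_zero, Module.End.one_apply] at h0; simp [h0]
    | succ k ih =>
      intro h0
      cases k with
      | zero => simpa using h0
      | succ k =>
        apply ih
        rw [pow_succ', Module.End.mul_apply]
        apply key
        rwa [pow_succ', pow_succ', Module.End.mul_apply, Module.End.mul_apply] at h0
  simpa using this k hk

/-- A bounded representation nontrivial along `X` has a weight that does not vanish at `X`. -/
theorem exists_weight (h : IsBoundedRep P D) {X : 𝔱} (hX : ∃ s : ℝ, P (s • X) ≠ 1) :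
    ∃ α : Module.Dual ℝ 𝔱, α X ≠ 0 ∧ ∃ Z : ℂ ⊗[ℝ] F, Z ≠ 0 ∧ ∀ Y,
      cx (P Y) Z = Complex.exp (2 * Real.pi * Complex.I * (α Y : ℂ)) • Z := by
  -- Joint generalized eigenspaces of the commuting generators span, and they consist of joint
  -- eigenvectors. If all had eigenvalue `0` at `X`, then `D X = 0` and `P (s X) = 1` for all `s`.
  obtain ⟨χ, hχX, Z, hZ0, hZ⟩ : ∃ χ : 𝔱 → ℂ, χ X ≠ 0 ∧ ∃ Z : ℂ ⊗[ℝ] F, Z ≠ 0 ∧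
      ∀ Y, cx (D Y) Z = χ Y • Z := by
    by_contra! H
    obtain ⟨s, hs⟩ := hX
    apply hs
    apply cx_injective
    have htop :=
      Module.End.iSup_iInf_maxGenEigenspace_eq_top_of_iSup_maxGenEigenspace_eq_top_of_commute
      (fun Y : 𝔱 => cx (D Y)) (fun Y Y' _ => by
        change cx (D Y) * cx (D Y') = cx (D Y') * cx (D Y)
        rw [← cx_mul, ← cx_mul, h.commute_generator])
      (fun Y => Module.End.iSup_maxGenEigenspace_eq_top _)
    have hker : (⊤ : Submodule ℂ (ℂ ⊗[ℝ] F)) ≤ LinearMap.ker (cx (D X)) := by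
      rw [← htop]
      refine iSup_le fun χ v hv => ?_
      have hv' : ∀ Y, cx (D Y) v = χ Y • v := fun Y =>
        h.eigen_of_mem_maxGenEigenspace ((Submodule.mem_iInf _).1 hv Y)
      rw [LinearMap.mem_ker]
      by_cases hv0 : v = 0
      · simp [hv0]
      by_cases hχ : χ X = 0
      · rw [hv' X, hχ, zero_smul]
      · obtain ⟨Y, hY⟩ := H χ hχ v hv0
        exact absurd (hv' Y) hY
    refine LinearMap.ext fun v => ?_
    have hv : cx (D X) v = (0 : ℂ) • v := by
      rw [zero_smul]; exact hker (Submodule.mem_top)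
    rw [h.apply_of_eigen hv s, cx_one]
    simp
  -- As `χ` is purely imaginary, `α = χ / (2πi)` is a real form; its linearity is read off from the
  -- action on `Z ≠ 0`.
  have hre : ∀ Y, (χ Y).re = 0 := fun Y => h.re_eigenvalue (hZ Y) hZ0
  have hinj := smul_left_injective ℂ hZ0
  have hχadd : ∀ Y Y', χ (Y + Y') = χ Y + χ Y' := by
    intro Y Y'
    apply hinj
    simp only [add_smul]
    rw [← hZ, ← hZ, ← hZ, _root_.map_add]
    simp [cx, LinearMap.baseChange_add]
  have hχsmul : ∀ (c : ℝ) Y, χ (c • Y) = c * χ Y := by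
    intro c Y
    apply hinj
    simp only [mul_smul]
    rw [← hZ, ← hZ, _root_.map_smul]
    simp only [cx, ContinuousLinearMap.toLinearMap_smul, LinearMap.baseChange_smul]
    rfl
  let α : Module.Dual ℝ 𝔱 :=
    { toFun := fun Y => (χ Y).im / (2 * Real.pi)
      map_add' := fun Y Y' => by rw [hχadd, Complex.add_im, add_div]
      map_smul' := fun c Y => by
        rw [hχsmul, Complex.im_ofReal_mul, mul_div_assoc]; rfl }
  have hα : ∀ Y, 2 * Real.pi * Complex.I * (α Y : ℂ) = χ Y := by
    intro Y
    have hpi : (Real.pi : ℂ) ≠ 0 := by exact_mod_cast Real.pi_ne_zero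
    have e : χ Y = ((χ Y).im : ℂ) * Complex.I := by
      conv_lhs => rw [← Complex.re_add_im (χ Y), hre Y]
      simp
    change 2 * Real.pi * Complex.I * (((χ Y).im / (2 * Real.pi) : ℝ) : ℂ) = χ Y
    push_cast
    rw [e]
    field_simp
    simp
  refine ⟨α, fun h0 => hχX ?_, Z, hZ0, fun Y => ?_⟩
  · rw [← hα, h0]; simp
  · have := h.apply_of_eigen (hZ Y) 1
    rw [hα]
    simpa using this

end IsBoundedRep

end BoundedRep

/-- A commuting family of operators on a finite-dimensional space, indexed by a real vector space,
has finitely many weights. -/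
theorem finite_weights {𝔱 V : Type*} [AddCommGroup 𝔱] [Module ℝ 𝔱] [AddCommGroup V] [Module ℂ V]
    [FiniteDimensional ℂ V] (p : 𝔱 → Module.End ℂ V) (hp : ∀ X Y, Commute (p X) (p Y)) :
    {α : Module.Dual ℝ 𝔱 | ∃ Z : V, Z ≠ 0 ∧ ∀ X,
      p X Z = Complex.exp (2 * Real.pi * Complex.I * (α X : ℂ)) • Z}.Finite := by
  have hind := Module.End.independent_iInf_maxGenEigenspace_of_forall_mapsTo p
    (fun i j φ => Module.End.mapsTo_maxGenEigenspace_of_comm (hp j i) φ)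
  -- An independent family in a finite-dimensional space has finitely many nonzero members.
  have hfin := WellFoundedGT.finite_ne_bot_of_iSupIndep hind
  refine Set.Finite.of_finite_image (f := fun α X =>
    Complex.exp (2 * Real.pi * Complex.I * (α X : ℂ))) (hfin.subset ?_) ?_
  · rintro _ ⟨α, ⟨Z, hZ, h⟩, rfl⟩ hbot
    apply hZ
    rw [← Submodule.mem_bot ℂ, ← hbot, Submodule.mem_iInf]
    intro X
    rw [Module.End.mem_maxGenEigenspace]
    exact ⟨1, by simp [h X]⟩
  · intro α _ β _ hαβ
    ext X
    by_contra hne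
    have hδ : α X - β X ≠ 0 := sub_ne_zero.2 hne
    -- At this multiple of `X` the values of `α` and `β` differ by `1/2`, so the two exponentials
    -- are opposite and cannot agree.
    have h1 := congrFun hαβ ((2 * (α X - β X))⁻¹ • X)
    simp only [map_smul, smul_eq_mul] at h1
    have h2 : 2 * Real.pi * Complex.I * (((2 * (α X - β X))⁻¹ * α X : ℝ) : ℂ) =
        2 * Real.pi * Complex.I * (((2 * (α X - β X))⁻¹ * β X : ℝ) : ℂ) + Real.pi * Complex.I := by
      have : (((2 * (α X - β X))⁻¹ * α X : ℝ)) = ((2 * (α X - β X))⁻¹ * β X : ℝ) + 1 / 2 := by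
        field_simp
        ring
      rw [this]
      push_cast
      ring
    rw [h2, Complex.exp_add, Complex.exp_pi_mul_I] at h1
    have h3 := Complex.exp_ne_zero
      (2 * Real.pi * Complex.I * (((2 * (α X - β X))⁻¹ * β X : ℝ) : ℂ))
    apply h3
    linear_combination (-1 / 2 : ℂ) * h1

end Weights

/-! ### Cells, their vertices, and the mean of the vertices. -/

section Polytope

variable {V : Type*} [AddCommGroup V] [Module ℝ V]

/-- The polytope cut out by `k α ≤ α x ≤ k α + 1` for `α ∈ R`. -/
def closedCell (R : Set (Module.Dual ℝ V)) (k : Module.Dual ℝ V → ℤ) : Set V :=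
  {x | ∀ α ∈ R, (k α : ℝ) ≤ α x ∧ α x ≤ k α + 1}

/-- The open polytope cut out by `k α < α x < k α + 1` for `α ∈ R`. -/
def openCell (R : Set (Module.Dual ℝ V)) (k : Module.Dual ℝ V → ℤ) : Set V :=
  {x | ∀ α ∈ R, (k α : ℝ) < α x ∧ α x < k α + 1}

variable {R : Set (Module.Dual ℝ V)} {k : Module.Dual ℝ V → ℤ}

theorem convex_closedCell : Convex ℝ (closedCell R k) := by
  intro x hx y hy a b ha hb hab α hα
  have h1 := hx α hα
  have h2 := hy α hα
  have hb' : b = 1 - a := by linarith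
  subst hb'
  simp only [map_add, map_smul, smul_eq_mul]
  constructor
  · nlinarith [mul_le_mul_of_nonneg_left h1.1 ha, mul_le_mul_of_nonneg_left h2.1 hb]
  · nlinarith [mul_le_mul_of_nonneg_left h1.2 ha, mul_le_mul_of_nonneg_left h2.2 hb]

/-- A strict inequality at one end stays strict on the open segment. This gives both convexity of
the open cell and its density in the closed one. -/
theorem openSegment_subset_openCell {x y : V} (hx : x ∈ openCell R k) (hy : y ∈ closedCell R k) :
    openSegment ℝ x y ⊆ openCell R k := by
  rintro _ ⟨a, b, ha, hb, hab, rfl⟩ α hα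
  have h1 := hx α hα
  have h2 := hy α hα
  have hb' : b = 1 - a := by linarith
  subst hb'
  simp only [map_add, map_smul, smul_eq_mul]
  constructor
  · nlinarith [mul_lt_mul_of_pos_left h1.1 ha, mul_le_mul_of_nonneg_left h2.1 hb.le]
  · nlinarith [mul_lt_mul_of_pos_left h1.2 ha, mul_le_mul_of_nonneg_left h2.2 hb.le]

theorem openCell_subset_closedCell : openCell R k ⊆ closedCell R k :=
  fun _ hx α hα => ⟨(hx α hα).1.le, (hx α hα).2.le⟩

/-- An affine permutation of a finite nonempty set fixes its mean. -/
theorem affine_mean_eq {S : Set V} (hS : S.Finite) (hne : S.Nonempty) (L : V →ₗ[ℝ] V) (c : V)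
    (hinj : Function.Injective fun x => c + L x) (hmaps : Set.MapsTo (fun x => c + L x) S S) :
    c + L ((S.ncard : ℝ)⁻¹ • ∑ᶠ v ∈ S, v) = (S.ncard : ℝ)⁻¹ • ∑ᶠ v ∈ S, v := by
  classical
  have hn : (S.ncard : ℝ) ≠ 0 := Nat.cast_ne_zero.2 ((Set.ncard_pos hS).2 hne).ne'
  have himg : hS.toFinset.image (fun x => c + L x) = hS.toFinset := by
    refine Finset.eq_of_subset_of_card_le (fun x hx => ?_)
      (Finset.card_image_of_injective _ hinj).ge
    obtain ⟨y, hy, rfl⟩ := Finset.mem_image.1 hx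
    exact hS.mem_toFinset.2 (hmaps (hS.mem_toFinset.1 hy))
  have hsum : ∑ v ∈ hS.toFinset, (c + L v) = ∑ v ∈ hS.toFinset, v := by
    conv_rhs => rw [← himg]
    rw [Finset.sum_image hinj.injOn]
  rw [finsum_mem_eq_finite_toFinset_sum _ hS]
  conv_rhs => rw [← hsum]
  rw [Finset.sum_add_distrib, Finset.sum_const, ← Set.ncard_eq_toFinset_card _ hS, smul_add,
    ← Nat.cast_smul_eq_nsmul ℝ, smul_smul, inv_mul_cancel₀ hn, one_smul, map_smul, map_sum]

theorem mapsTo_extremePoints_of_affine {Q : Set V} (L : V →ₗ[ℝ] V) (c : V)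
    (hinj : Function.Injective fun x => c + L x) (hQ : (fun x => c + L x) '' Q = Q) :
    Set.MapsTo (fun x => c + L x) (Q.extremePoints ℝ) (Q.extremePoints ℝ) := by
  intro v hv
  refine ⟨hQ ▸ Set.mem_image_of_mem _ hv.1, ?_⟩
  intro x hx y hy hvxy
  rw [← hQ] at hx hy
  obtain ⟨x, hx, rfl⟩ := hx
  obtain ⟨y, hy, rfl⟩ := hy
  obtain ⟨a, b, ha, hb, hab, h⟩ := hvxy
  have hv' : v ∈ openSegment ℝ x y := by
    refine ⟨a, b, ha, hb, hab, hinj ?_⟩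
    simp only at h ⊢
    rw [← h, map_add, map_smul, map_smul, smul_add, smul_add]
    have : c = a • c + b • c := by rw [← add_smul, hab, one_smul]
    nth_rewrite 1 [this]
    abel
  exact congrArg (fun x => c + L x) (hv.2 hx hy hv')

theorem isPreconnected_openCell [TopologicalSpace V] [IsTopologicalAddGroup V]
    [ContinuousSMul ℝ V] : IsPreconnected (openCell R k) :=
  (convex_iff_openSegment_subset.2 fun _ hx _ hy =>
    openSegment_subset_openCell hx (openCell_subset_closedCell hy)).isPreconnected

variable [TopologicalSpace V] [IsTopologicalAddGroup V] [ContinuousSMul ℝ V] [T2Space V]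
  [FiniteDimensional ℝ V]

theorem continuous_dual (α : Module.Dual ℝ V) : Continuous α :=
  α.continuous_of_finiteDimensional

theorem isClosed_closedCell : IsClosed (closedCell R k) := by
  have : closedCell R k = ⋂ α ∈ R, (α ⁻¹' Set.Icc (k α : ℝ) (k α + 1)) := by
    ext x; simp [closedCell]
  rw [this]
  exact isClosed_biInter fun α _ => isClosed_Icc.preimage (continuous_dual α)

theorem closure_openCell (hne : (openCell R k).Nonempty) :
    closure (openCell R k) = closedCell R k := by
  refine (closure_minimal openCell_subset_closedCell isClosed_closedCell).antisymm fun x hx => ?_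
  obtain ⟨a, ha⟩ := hne
  exact closure_mono (openSegment_subset_openCell ha hx)
    (segment_subset_closure_openSegment (right_mem_segment ℝ a x))

/-- By separation, evaluation at `R` embeds `V` as a closed subspace of `ℝ^R`, and the cell is the
preimage of a box. -/
theorem isCompact_closedCell (hR : R.Finite) (hsep : ∀ x, (∀ α ∈ R, α x = 0) → x = 0) :
    IsCompact (closedCell R k) := by
  have := hR.fintype
  let f : V →ₗ[ℝ] (R → ℝ) := LinearMap.pi fun α => (α : Module.Dual ℝ V)
  have hf : LinearMap.ker f = ⊥ := by
    rw [LinearMap.ker_eq_bot']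
    intro x hx
    exact hsep x fun α hα => congrFun hx ⟨α, hα⟩
  have hemb := LinearMap.isClosedEmbedding_of_injective hf
  have : closedCell R k = f ⁻¹' Set.Icc (fun α : R => (k α : ℝ)) (fun α : R => (k α : ℝ) + 1) := by
    ext x
    simp [closedCell, f, Pi.le_def, forall_and]
  rw [this]
  exact hemb.isCompact_preimage isCompact_Icc

/-- A vertex is determined by its active constraints. If `v` and `w` share them, `v` can be pushed
slightly away from `w` inside the cell; it then lies strictly between `w` and the pushed point, so
`w = v` by extremality. -/
theorem finite_extremePoints_closedCell (hR : R.Finite) :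
    ((closedCell R k).extremePoints ℝ).Finite := by
  refine Set.Finite.of_injOn (f := fun v => ({α ∈ R | α v = k α}, {α ∈ R | α v = k α + 1}))
    (t := R.powerset ×ˢ R.powerset) ?_ ?_ (hR.finite_subsets.prod hR.finite_subsets)
  · intro v _
    exact ⟨Set.sep_subset _ _, Set.sep_subset _ _⟩
  intro v hv w hw hvw
  simp only [Prod.mk.injEq] at hvw
  have hev : ∀ᶠ ε : ℝ in 𝓝[>] 0, ∀ α ∈ R,
      (k α : ℝ) ≤ α (v - ε • (w - v)) ∧ α (v - ε • (w - v)) ≤ k α + 1 := by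
    rw [Filter.eventually_all_finite hR]
    intro α hα
    have hα' := hv.1 α hα
    have hc : Filter.Tendsto (fun ε : ℝ => α (v - ε • (w - v))) (𝓝[>] 0) (𝓝 (α v)) := by
      have : Continuous fun ε : ℝ => α (v - ε • (w - v)) := (continuous_dual α).comp (by fun_prop)
      have h0 := (this.tendsto 0).mono_left (nhdsWithin_le_nhds (s := Set.Ioi 0))
      simpa using h0
    have hflat : α w = α v → ∀ ε : ℝ, α (v - ε • (w - v)) = α v := fun h ε => by simp [h]
    refine Filter.Eventually.and ?_ ?_
    · rcases hα'.1.eq_or_lt with h | h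
      · have hw' : α ∈ {α ∈ R | α w = k α} := hvw.1 ▸ ⟨hα, h.symm⟩
        exact Filter.Eventually.of_forall fun ε => by rw [hflat (hw'.2.trans h)]; exact hα'.1
      · exact (Filter.Tendsto.eventually_const_lt h hc).mono fun _ => le_of_lt
    · rcases hα'.2.eq_or_lt with h | h
      · have hw' : α ∈ {α ∈ R | α w = k α + 1} := hvw.2 ▸ ⟨hα, h⟩
        exact Filter.Eventually.of_forall fun ε => by rw [hflat (hw'.2.trans h.symm)]; exact hα'.2
      · exact (Filter.Tendsto.eventually_lt_const h hc).mono fun _ => le_of_lt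
  obtain ⟨ε, hε, hε0⟩ := (hev.and self_mem_nhdsWithin).exists
  have hε0 : 0 < ε := hε0
  have hmem : v ∈ openSegment ℝ w (v - ε • (w - v)) := by
    -- These weights solve `v = a w + b (v - ε (w - v))` with `a + b = 1`.
    refine ⟨ε / (1 + ε), 1 / (1 + ε), by positivity, by positivity, by field_simp; ring, ?_⟩
    have h1 : (1 + ε) ≠ 0 := by positivity
    have h2 : (1 / (1 + ε)) * ε = ε / (1 + ε) := by ring
    have h3 : 1 / (1 + ε) + ε / (1 + ε) = 1 := by field_simp
    rw [smul_sub, smul_smul, h2, smul_sub]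
    calc _ = (1 / (1 + ε) + ε / (1 + ε)) • v := by rw [add_smul]; abel
      _ = v := by rw [h3, one_smul]
  exact (hv.2 hw.1 hε hmem).symm

/-- By Krein–Milman, if `f ≤ c` at all vertices then `f ≤ c` on `Q`, against `y`. So some vertex is
strictly above `c`, none is below, and the mean is strictly above. -/
theorem lt_mean_of_extremePoints [LocallyConvexSpace ℝ V] {Q : Set V} (hQ : IsCompact Q) (hconv : Convex ℝ Q)
    (hfin : (Q.extremePoints ℝ).Finite) (f : Module.Dual ℝ V) {c : ℝ} (hc : ∀ x ∈ Q, c ≤ f x)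
    {y : V} (hy : y ∈ Q) (hcy : c < f y) :
    c < f (((Q.extremePoints ℝ).ncard : ℝ)⁻¹ • ∑ᶠ v ∈ Q.extremePoints ℝ, v) := by
  obtain ⟨v, hv, hcv⟩ : ∃ v ∈ Q.extremePoints ℝ, c < f v := by
    by_contra! H
    have h1 : closure (convexHull ℝ (Q.extremePoints ℝ)) ⊆ {x | f x ≤ c} :=
      closure_minimal (convexHull_min H (convex_halfSpace_le f.isLinear c))
        (isClosed_le (continuous_dual f) continuous_const)
    rw [closure_convexHull_extremePoints hQ hconv] at h1
    exact absurd (h1 hy) (not_le.2 hcy)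
  have hn : 0 < ((Q.extremePoints ℝ).ncard : ℝ) :=
    Nat.cast_pos.2 ((Set.ncard_pos hfin).2 ⟨v, hv⟩)
  have hsum : ((Q.extremePoints ℝ).ncard : ℝ) * c < ∑ v ∈ hfin.toFinset, f v := by
    rw [Set.ncard_eq_toFinset_card _ hfin, ← nsmul_eq_mul, ← Finset.sum_const]
    exact Finset.sum_lt_sum (fun x hx => hc x (extremePoints_subset (hfin.mem_toFinset.1 hx)))
      ⟨v, hfin.mem_toFinset.2 hv, hcv⟩
  rw [finsum_mem_eq_finite_toFinset_sum _ hfin, map_smul, map_sum, smul_eq_mul]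
  rwa [← div_eq_inv_mul, lt_div_iff₀ hn, mul_comm]

/-- The mean of the vertices of a bounded cell is an interior point. -/
theorem mean_mem_openCell [LocallyConvexSpace ℝ V] (hR : R.Finite) (hsep : ∀ x, (∀ α ∈ R, α x = 0) → x = 0)
    (hne : (openCell R k).Nonempty) :
    (((closedCell R k).extremePoints ℝ).ncard : ℝ)⁻¹ •
      ∑ᶠ v ∈ (closedCell R k).extremePoints ℝ, v ∈ openCell R k := by
  obtain ⟨y, hy⟩ := hne
  have hQ := isCompact_closedCell (k := k) hR hsep
  have hfin := finite_extremePoints_closedCell (k := k) hR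
  have hyQ := openCell_subset_closedCell hy
  intro α hα
  refine ⟨lt_mean_of_extremePoints hQ convex_closedCell hfin α (fun x hx => (hx α hα).1) hyQ
    (hy α hα).1, ?_⟩
  have := lt_mean_of_extremePoints hQ convex_closedCell hfin (-α) (c := -(k α + 1))
    (fun x hx => neg_le_neg (hx α hα).2) hyQ (neg_lt_neg (hy α hα).2)
  exact neg_lt_neg_iff.1 this

end Polytope

namespace MaximalTorus

/-! ### Roots, and the action of the extended affine Weyl group on alcoves. -/

section Roots

variable {E : Type*} [NormedAddCommGroup E] [NormedSpace ℝ E]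
  {G : Type*} [TopologicalSpace G] [ChartedSpace E G] [Group G] [LieGroup 𝓘(ℝ, E) ∞ G]
  (T : MaximalTorus G)

instance : T2Space (T.lieAlgebra E) :=
  have : T2Space (GroupLieAlgebra 𝓘(ℝ, E) G) := inferInstanceAs (T2Space E)
  inferInstance

instance : LocallyConvexSpace ℝ (T.lieAlgebra E) :=
  have : LocallyConvexSpace ℝ (GroupLieAlgebra 𝓘(ℝ, E) G) :=
    inferInstanceAs (LocallyConvexSpace ℝ E)
  inferInstance

instance [FiniteDimensional ℝ E] : FiniteDimensional ℝ (T.lieAlgebra E) :=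
  have : FiniteDimensional ℝ (GroupLieAlgebra 𝓘(ℝ, E) G) :=
    inferInstanceAs (FiniteDimensional ℝ E)
  inferInstance

theorem exp_smul_eq (X : T.lieAlgebra E) {φ : ℝ → G} (hφ : ∀ s, φ s ∈ T.sub)
    (h : IsOneParam φ (X : GroupLieAlgebra 𝓘(ℝ, E) G)) (s : ℝ) :
    ((T.exp E (s • X)).toMul : G) = φ s := by
  have := T.expFun_eq (s • X) (fun u => hφ (s * u)) (h.smul s)
  rw [mul_one] at this
  exact this

/-- The adjoint action of `exp X` on the Lie algebra of `G`. -/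
def adExp (X : T.lieAlgebra E) : E →L[ℝ] E := adModel E ((T.exp E X).toMul : G)

/-- The infinitesimal generators of `adExp`. -/
def adGenerator : T.lieAlgebra E →ₗ[ℝ] (E →L[ℝ] E) :=
  (adModelDeriv E G).toLinearMap ∘ₗ (T.lieAlgebra E).subtype

/-- Compactness of `G` gives the bound: the image of `G` under the continuous map `adModel E` is
compact. -/
theorem isBoundedRep_adExp [CompactSpace G] :
    IsBoundedRep T.adExp (T.adGenerator (E := E)) where
  map_zero := by
    have : ((T.exp E 0).toMul : G) = 1 := by rw [map_zero]; rfl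
    change Ad E ((T.exp E 0).toMul : G) = _
    rw [this]
    exact Ad_one
  map_add X Y := by
    have : ((T.exp E (X + Y)).toMul : G) = (T.exp E X).toMul * (T.exp E Y).toMul := by
      rw [map_add]; rfl
    change Ad E ((T.exp E (X + Y)).toMul : G) = _
    rw [this]
    exact Ad_mul _ _
  hasDerivAt_zero X := by
    obtain ⟨φ, hφ, hX⟩ := X.2
    have e : (fun s : ℝ => T.adExp (s • X)) = fun s => adModel E (φ s) := by
      funext s
      exact congrArg (adModel E) (T.exp_smul_eq X hφ hX s)
    rw [e]
    exact hX.hasDerivAt_adModel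
  bounded := by
    have hc : IsCompact (Set.range (adModel E : G → E →L[ℝ] E)) :=
      isCompact_range contMDiff_adModel.continuous
    obtain ⟨C, hC⟩ := hc.isBounded.exists_norm_le
    exact ⟨C, fun X => hC _ (Set.mem_range_self _)⟩

/-- If `G` has trivial centre, its roots separate the points of `𝔱`. -/
theorem exists_root [FiniteDimensional ℝ E] [CompactSpace G] [PreconnectedSpace G]
    (hG : Subgroup.center G = ⊥) {X : T.lieAlgebra E} (hX : X ≠ 0) :
    ∃ α, T.IsRoot E α ∧ α X ≠ 0 := by
  -- Otherwise the whole one-parameter subgroup is central, hence trivial, and its velocity `X` is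
  -- `0`.
  have hnt : ∃ s : ℝ, T.adExp (s • X) ≠ 1 := by
    by_contra! H
    obtain ⟨φ, hφ, hφX⟩ := X.2
    have h1 : φ = fun _ => 1 := by
      funext s
      have h2 : ((T.exp E (s • X)).toMul : G) ∈ Subgroup.center G :=
        mem_center_of_Ad_eq_id (H s)
      rw [hG, Subgroup.mem_bot, T.exp_smul_eq X hφ hφX s] at h2
      exact h2
    subst h1
    exact hX (Subtype.ext (hφX.velocity_unique IsOneParam.const))
  obtain ⟨α, hα, Z, hZ, h⟩ := T.isBoundedRep_adExp.exists_weight hnt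
  exact ⟨α, ⟨fun h0 => hα (by rw [h0]; rfl), Z, hZ, h⟩, hα⟩

theorem finite_roots [FiniteDimensional ℝ E] : {α | T.IsRoot E α}.Finite := by
  refine (finite_weights (fun X : T.lieAlgebra E => IsBoundedRep.cx (T.adExp X)) ?_).subset
    fun α hα => hα.2
  intro X Y
  have h : ∀ X Y : T.lieAlgebra E, T.adExp X * T.adExp Y = T.adExp (X + Y) := by
    intro X Y
    have : ((T.exp E (X + Y)).toMul : G) = (T.exp E X).toMul * (T.exp E Y).toMul := by
      rw [map_add]; rfl
    refine (Ad_mul _ _).symm.trans ?_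
    rw [← this]
    rfl
  change IsBoundedRep.cx _ * IsBoundedRep.cx _ = IsBoundedRep.cx _ * IsBoundedRep.cx _
  rw [← IsBoundedRep.cx_mul, ← IsBoundedRep.cx_mul, h, h, add_comm]

/-- The Weyl group permutes the roots. -/
theorem isRoot_comp_weyl {α : Module.Dual ℝ (T.lieAlgebra E)} (hα : T.IsRoot E α) (w : T.Weyl) :
    T.IsRoot E (α ∘ₗ T.weylOnLie E w) := by
  obtain ⟨hα0, Z, hZ0, hZ⟩ := hα
  obtain ⟨n, hn⟩ := QuotientGroup.mk_surjective w
  have hmul : ∀ a b : G, (Ad E (a * b)).toLinearMap.baseChange ℂ =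
      (Ad E a).toLinearMap.baseChange ℂ ∘ₗ (Ad E b).toLinearMap.baseChange ℂ := by
    intro a b
    rw [Ad_mul, ← LinearMap.baseChange_comp]
    rfl
  have hconj : ∀ X : T.lieAlgebra E, ((T.exp E (T.weylOnLie E w X)).toMul : G) =
      n * (T.exp E X).toMul * (n : G)⁻¹ := by
    intro X
    have h1 := congrArg (Subtype.val : T.sub → G) (T.exp_smul E w X)
    rw [← hn] at h1 ⊢
    exact h1
  -- If `n` represents `w`, then `exp X * n⁻¹ = n⁻¹ * exp (w X)`, so `Ad n⁻¹` carries a weight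
  -- vector for `α` to one for `α ∘ w`.
  refine ⟨fun h0 => hα0 ?_, (Ad E (n : G)⁻¹).toLinearMap.baseChange ℂ Z, fun h0 => hZ0 ?_,
    fun X => ?_⟩
  · ext X
    have h1 := DFunLike.congr_fun h0 (T.weylOnLie E w⁻¹ X)
    have h2 : T.weylOnLie E w (T.weylOnLie E w⁻¹ X) = X := by
      rw [← Module.End.mul_apply, ← map_mul, mul_inv_cancel, map_one]; rfl
    rw [LinearMap.comp_apply, h2] at h1
    exact h1
  · have h1 := LinearMap.congr_fun (hmul (n : G) (n : G)⁻¹) Z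
    rw [LinearMap.comp_apply, h0, map_zero, mul_inv_cancel, Ad_one] at h1
    rw [← h1]
    exact (LinearMap.congr_fun (LinearMap.baseChange_id (A := ℂ)) Z).symm
  · rw [← LinearMap.comp_apply, ← hmul]
    have e : ((T.exp E X).toMul : G) * (n : G)⁻¹ =
        (n : G)⁻¹ * (T.exp E (T.weylOnLie E w X)).toMul := by
      rw [hconj]; group
    rw [e, hmul, LinearMap.comp_apply, hZ, map_smul]
    rfl

/-- Roots take integral values on the lattice `Γ(T)`. -/
theorem exists_int_of_mem_lattice {α : Module.Dual ℝ (T.lieAlgebra E)} (hα : T.IsRoot E α)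
    {γ : T.lieAlgebra E} (hγ : γ ∈ T.lattice E) : ∃ m : ℤ, α γ = m := by
  obtain ⟨-, Z, hZ0, hZ⟩ := hα
  have h1 : ((T.exp E γ).toMul : G) = 1 := by
    have : T.exp E γ = 0 := hγ
    rw [this]; rfl
  have h2 := hZ γ
  rw [h1, Ad_one] at h2
  have h3 : Z = Complex.exp (2 * Real.pi * Complex.I * (α γ : ℂ)) • Z :=
    (LinearMap.congr_fun (LinearMap.baseChange_id (A := ℂ)) Z).symm.trans h2
  have h4 : Complex.exp (2 * Real.pi * Complex.I * (α γ : ℂ)) = 1 :=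
    smul_left_injective ℂ hZ0 (by simpa using h3.symm)
  obtain ⟨m, hm⟩ := Complex.exp_eq_one_iff.1 h4
  refine ⟨m, ?_⟩
  have h5 : (2 * Real.pi * Complex.I) * ((α γ : ℂ) - m) = 0 := by linear_combination hm
  have h6 := (mul_eq_zero.1 h5).resolve_left Complex.two_pi_I_ne_zero
  exact_mod_cast sub_eq_zero.1 h6

theorem mem_regularSet {x : T.lieAlgebra E} :
    x ∈ T.regularSet E ↔ ∀ α, T.IsRoot E α → ∀ k : ℤ, α x ≠ k := by
  simp [regularSet, singularHyperplane]

theorem extAffineWeyl_smul_def (g : T.ExtAffineWeyl E) (x : T.lieAlgebra E) :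
    g • x = ((g.left.toAdd : T.lattice E) : T.lieAlgebra E) + T.weylOnLie E g.right x := rfl

theorem smul_mem_regularSet (g : T.ExtAffineWeyl E) {x : T.lieAlgebra E}
    (hx : x ∈ T.regularSet E) : g • x ∈ T.regularSet E := by
  rw [mem_regularSet] at hx ⊢
  intro α hα k hk
  obtain ⟨m, hm⟩ := T.exists_int_of_mem_lattice hα (g.left.toAdd : T.lattice E).2
  -- With `g = γ w` and `m = α γ`, the hyperplane `α = k` pulls back to the singular hyperplane `α ∘
  -- w = k - m`.
  refine hx _ (T.isRoot_comp_weyl hα g.right) (k - m) ?_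
  rw [extAffineWeyl_smul_def, map_add, hm] at hk
  rw [LinearMap.comp_apply]
  push_cast
  linarith

theorem smul_regularSet (g : T.ExtAffineWeyl E) : g • T.regularSet E = T.regularSet E := by
  refine (Set.smul_set_subset_iff.2 fun x hx => T.smul_mem_regularSet g hx).antisymm fun x hx => ?_
  exact Set.mem_smul_set_iff_inv_smul_mem.2 (T.smul_mem_regularSet g⁻¹ hx)

variable [FiniteDimensional ℝ E]

instance : ContinuousConstSMul (T.ExtAffineWeyl E) (T.lieAlgebra E) where
  continuous_const_smul g :=
    continuous_const.add (T.weylOnLie E g.right).continuous_of_finiteDimensional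

theorem smul_connectedComponentIn_regularSet (g : T.ExtAffineWeyl E) {x : T.lieAlgebra E}
    (hx : x ∈ T.regularSet E) : g • connectedComponentIn (T.regularSet E) x =
      connectedComponentIn (T.regularSet E) (g • x) := by
  have := (Homeomorph.smul g).image_connectedComponentIn hx
  rw [← T.smul_regularSet g]
  nth_rewrite 1 [T.smul_regularSet g]
  exact this

/-- An alcove is the cell of any of its points. -/
theorem connectedComponentIn_regularSet {x : T.lieAlgebra E} (hx : x ∈ T.regularSet E) :
    connectedComponentIn (T.regularSet E) x = openCell {α | T.IsRoot E α} fun α => ⌊α x⌋ := by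
  have hreg := T.mem_regularSet.1 hx
  have hxc : x ∈ openCell {α | T.IsRoot E α} fun α => ⌊α x⌋ := fun α hα =>
    ⟨lt_of_le_of_ne (Int.floor_le _) (hreg α hα _).symm, Int.lt_floor_add_one _⟩
  refine Set.Subset.antisymm (fun y hy α hα => ?_)
    (isPreconnected_openCell.subset_connectedComponentIn hxc fun y hy => ?_)
  -- The image of the component under `α` is an interval without integers, so it stays between `⌊α
  -- x⌋` and `⌊α x⌋ + 1`.
  · have hord : (α '' connectedComponentIn (T.regularSet E) x).OrdConnected :=
      (isPreconnected_connectedComponentIn.image α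
        (continuous_dual α).continuousOn).ordConnected
    have hxm : α x ∈ α '' connectedComponentIn (T.regularSet E) x :=
      Set.mem_image_of_mem _ (mem_connectedComponentIn hx)
    have hym := Set.mem_image_of_mem α hy
    have hno : ∀ k : ℤ, (k : ℝ) ∉ α '' connectedComponentIn (T.regularSet E) x := by
      rintro k ⟨z, hz, hzk⟩
      exact T.mem_regularSet.1 (connectedComponentIn_subset _ _ hz) α hα k hzk
    constructor
    · by_contra! h
      exact hno _ (hord.out hym hxm ⟨h, Int.floor_le _⟩)
    · by_contra! h
      refine hno (⌊α x⌋ + 1) (hord.out hxm hym ?_)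
      push_cast
      exact ⟨(Int.lt_floor_add_one _).le, h⟩
  · rw [mem_regularSet]
    intro α hα k hk
    have h := hy α hα
    rw [hk] at h
    have h1 : ⌊α x⌋ < k := by exact_mod_cast h.1
    have h2 : k < ⌊α x⌋ + 1 := by exact_mod_cast h.2
    omega

variable {T}

theorem IsAlcove.exists_eq_openCell {A : Set (T.lieAlgebra E)} (hA : T.IsAlcove E A) :
    ∃ k, A = openCell {α | T.IsRoot E α} k ∧ (openCell {α | T.IsRoot E α} k).Nonempty := by
  obtain ⟨x, hx, rfl⟩ := hA
  refine ⟨_, T.connectedComponentIn_regularSet hx, x, ?_⟩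
  rw [← T.connectedComponentIn_regularSet hx]
  exact mem_connectedComponentIn hx

/-- Components are permuted by `g`, and `A` is the component of the fixed point `x`. -/
theorem IsAlcove.smul_eq_self {A : Set (T.lieAlgebra E)} (hA : T.IsAlcove E A)
    {x : T.lieAlgebra E} (hx : x ∈ A) {g : T.ExtAffineWeyl E} (hg : g • x = x) : g • A = A := by
  obtain ⟨y, hy, rfl⟩ := hA
  have hxr := connectedComponentIn_subset _ _ hx
  rw [connectedComponentIn_eq hx, T.smul_connectedComponentIn_regularSet g hxr, hg]

variable [CompactSpace G] [PreconnectedSpace G]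

theorem IsAlcove.barycentre_mem (hG : Subgroup.center G = ⊥) {A : Set (T.lieAlgebra E)}
    (hA : T.IsAlcove E A) : T.barycentre E A ∈ A := by
  obtain ⟨k, rfl, hne⟩ := hA.exists_eq_openCell
  unfold barycentre vertices
  rw [closure_openCell hne]
  refine mean_mem_openCell T.finite_roots (fun x hx => ?_) hne
  by_contra h0
  obtain ⟨α, hα, hαx⟩ := T.exists_root hG h0
  exact hαx (hx α hα)

/-- An affine bijection preserving `A` preserves its closure, hence the set of extreme points. That
set is finite, and nonempty by compactness, so `affine_mean_eq` applies. -/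
theorem IsAlcove.smul_barycentre (hG : Subgroup.center G = ⊥) {A : Set (T.lieAlgebra E)}
    (hA : T.IsAlcove E A) {g : T.ExtAffineWeyl E} (hg : g • A = A) :
    g • T.barycentre E A = T.barycentre E A := by
  obtain ⟨k, hk, hne⟩ := hA.exists_eq_openCell
  have hcl : closure A = closedCell {α | T.IsRoot E α} k := by rw [hk, closure_openCell hne]
  have hfin : (T.vertices E A).Finite := by
    unfold vertices
    rw [hcl]
    exact finite_extremePoints_closedCell T.finite_roots
  have hcomp : IsCompact (closure A) := by
    rw [hcl]
    refine isCompact_closedCell T.finite_roots (fun x hx => ?_)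
    by_contra h0
    obtain ⟨α, hα, hαx⟩ := T.exists_root hG h0
    exact hαx (hx α hα)
  have hnev : (T.vertices E A).Nonempty :=
    hcomp.extremePoints_nonempty (hk ▸ hne).closure
  have hinj : Function.Injective fun x : T.lieAlgebra E =>
      ((g.left.toAdd : T.lattice E) : T.lieAlgebra E) + T.weylOnLie E g.right x :=
    MulAction.injective g
  refine affine_mean_eq hfin hnev _ _ hinj (mapsTo_extremePoints_of_affine _ _ hinj ?_)
  have := closure_smul g A
  rw [hg] at this
  exact this.symm

end Roots

/-! ### Stabilizers of `x` and of `exp x`. -/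

section Correspondence

variable {E : Type*} [NormedAddCommGroup E] [NormedSpace ℝ E]
  {G : Type*} [TopologicalSpace G] [ChartedSpace E G] [Group G] [LieGroup 𝓘(ℝ, E) ∞ G]
  (T : MaximalTorus G)

theorem inl_mul_inr_smul (γ : Multiplicative (T.lattice E)) (w : T.Weyl) (x : T.lieAlgebra E) :
    (SemidirectProduct.inl γ * SemidirectProduct.inr w : T.ExtAffineWeyl E) • x =
      ((γ.toAdd : T.lattice E) : T.lieAlgebra E) + w • x := by
  rw [extAffineWeyl_smul_def]
  simp only [SemidirectProduct.mul_left, SemidirectProduct.left_inl, SemidirectProduct.right_inl,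
    SemidirectProduct.left_inr, map_one, mul_one, SemidirectProduct.mul_right,
    SemidirectProduct.right_inr, one_mul]
  rfl

/-- Since `w • exp x = exp (w • x)`, fixing `exp x` means that `x` and `w • x` differ by an element
of the kernel of `exp`. -/
theorem mem_stabilizer_exp_iff {w : T.Weyl} {x : T.lieAlgebra E} :
    w ∈ MulAction.stabilizer T.Weyl (T.exp E x).toMul ↔ x - w • x ∈ T.lattice E := by
  rw [MulAction.mem_stabilizer_iff, ← exp_smul, lattice, AddMonoidHom.mem_ker, map_sub,
    sub_eq_zero, eq_comm]
  exact Additive.toMul.injective.eq_iff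

theorem existsUnique_translation {w : T.Weyl} {x : T.lieAlgebra E}
    (hw : w ∈ MulAction.stabilizer T.Weyl (T.exp E x).toMul) :
    ∃! γ : Multiplicative (T.lattice E),
      (SemidirectProduct.inl γ * SemidirectProduct.inr w : T.ExtAffineWeyl E) • x = x := by
  refine ⟨Multiplicative.ofAdd ⟨_, T.mem_stabilizer_exp_iff.1 hw⟩, ?_, fun γ hγ => ?_⟩
  · simp only [inl_mul_inr_smul]
    exact sub_add_cancel _ _
  · simp only [inl_mul_inr_smul] at hγ
    exact Multiplicative.toAdd.injective (Subtype.ext (eq_sub_of_add_eq hγ))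

theorem right_mem_stabilizer_exp {g : T.ExtAffineWeyl E} {x : T.lieAlgebra E} (hg : g • x = x) :
    g.right ∈ MulAction.stabilizer T.Weyl (T.exp E x).toMul := by
  rw [mem_stabilizer_exp_iff]
  have h1 : ((g.left.toAdd : T.lattice E) : T.lieAlgebra E) + g.right • x = x := hg
  rw [← eq_sub_of_add_eq h1]
  exact (g.left.toAdd : T.lattice E).2

/-- Projection to `W` maps the stabilizer of `x` to the stabilizer of `exp x`. -/
def stabilizerHom (x : T.lieAlgebra E) :
    MulAction.stabilizer (T.ExtAffineWeyl E) x →*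
      MulAction.stabilizer T.Weyl (T.exp E x).toMul where
  toFun g := ⟨g.1.right, T.right_mem_stabilizer_exp g.2⟩
  map_one' := rfl
  map_mul' _ _ := rfl

/-- Projection to `W` identifies the stabilizer of `x` in `Γ(T) ⋊ W` with the stabilizer of
`exp x` in `W`. -/
def stabilizerEquiv (x : T.lieAlgebra E) :
    MulAction.stabilizer (T.ExtAffineWeyl E) x ≃*
      MulAction.stabilizer T.Weyl (T.exp E x).toMul :=
  MulEquiv.ofBijective (T.stabilizerHom x) (by
    constructor
    -- The translation part of an element fixing `x` is forced to be `x - w • x` by its Weyl part.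
    · intro g h hgh
      have hr : g.1.right = h.1.right := congrArg Subtype.val hgh
      have hg : ((g.1.left.toAdd : T.lattice E) : T.lieAlgebra E) + g.1.right • x = x := g.2
      have hh : ((h.1.left.toAdd : T.lattice E) : T.lieAlgebra E) + h.1.right • x = x := h.2
      refine Subtype.ext (SemidirectProduct.ext ?_ hr)
      refine Multiplicative.toAdd.injective (Subtype.ext ?_)
      rw [hr] at hg
      exact add_right_cancel (hg.trans hh.symm)
    · intro w
      obtain ⟨γ, hγ, -⟩ := T.existsUnique_translation w.2
      exact ⟨⟨_, hγ⟩, Subtype.ext (by simp [stabilizerHom])⟩)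

theorem stabilizerEquiv_symm_apply {x : T.lieAlgebra E}
    (w : MulAction.stabilizer T.Weyl (T.exp E x).toMul) {γ : Multiplicative (T.lattice E)}
    (hγ : (SemidirectProduct.inl γ * SemidirectProduct.inr (w : T.Weyl) : T.ExtAffineWeyl E) • x
      = x) :
    ((T.stabilizerEquiv x).symm w : T.ExtAffineWeyl E) =
      SemidirectProduct.inl γ * SemidirectProduct.inr (w : T.Weyl) := by
  have : (T.stabilizerEquiv x).symm w = ⟨_, hγ⟩ := by
    rw [MulEquiv.symm_apply_eq]
    exact Subtype.ext (by simp [stabilizerEquiv, stabilizerHom])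
  rw [this]

variable {T} [FiniteDimensional ℝ E] [CompactSpace G] [PreconnectedSpace G]

/-- The stabilizer of an alcove is the stabilizer of its barycentre. -/
theorem IsAlcove.stabilizer_barycentre (hG : Subgroup.center G = ⊥) {A : Set (T.lieAlgebra E)}
    (hA : T.IsAlcove E A) : MulAction.stabilizer (T.ExtAffineWeyl E) (T.barycentre E A) =
      MulAction.stabilizer (T.ExtAffineWeyl E) A := by
  ext g
  simp only [MulAction.mem_stabilizer_iff]
  exact ⟨hA.smul_eq_self (hA.barycentre_mem hG), hA.smul_barycentre hG⟩

end Correspondence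

end MaximalTorus

end AlcoveLie

end

/-! ### The main theorem. -/

open AlcoveLie
theorem mainTheorem4 {E : Type*} [NormedAddCommGroup E] [NormedSpace ℝ E] [FiniteDimensional ℝ E]
    {G : Type*} [TopologicalSpace G] [T2Space G] [CompactSpace G] [ConnectedSpace G]
    [ChartedSpace E G] [Group G] [LieGroup 𝓘(ℝ, E) ∞ G]
    (hG : Subgroup.center G = ⊥) (T : MaximalTorus G)
    (A : Set (T.lieAlgebra E)) (hA : T.IsAlcove E A)
    (x₀ : T.lieAlgebra E) (hx₀ : x₀ = T.barycentre E A)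
    (t₀ : T.sub) (ht₀ : t₀ = (T.exp E x₀).toMul) :
    (∀ w ∈ MulAction.stabilizer T.Weyl t₀, ∃! γ : Multiplicative (T.lattice E),
      (SemidirectProduct.inl γ * SemidirectProduct.inr w : T.ExtAffineWeyl E) • x₀ = x₀) ∧
    ∃! Φ : MulAction.stabilizer T.Weyl t₀ ≃* MulAction.stabilizer (T.ExtAffineWeyl E) A,
      ∀ (w : MulAction.stabilizer T.Weyl t₀) (γ : Multiplicative (T.lattice E)),
        (SemidirectProduct.inl γ * SemidirectProduct.inr (w : T.Weyl) : T.ExtAffineWeyl E) • x₀ = x₀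
          → (Φ w : T.ExtAffineWeyl E) =
            SemidirectProduct.inl γ * SemidirectProduct.inr (w : T.Weyl) := by
  subst ht₀
  have hstab : MulAction.stabilizer (T.ExtAffineWeyl E) x₀ =
      MulAction.stabilizer (T.ExtAffineWeyl E) A := by
    rw [hx₀]; exact hA.stabilizer_barycentre hG
  refine ⟨fun w hw => T.existsUnique_translation hw,
    (T.stabilizerEquiv x₀).symm.trans (MulEquiv.subgroupCongr hstab), fun w γ hγ => ?_,
    fun Ψ hΨ => ?_⟩
  · exact T.stabilizerEquiv_symm_apply w hγ
  · refine MulEquiv.ext fun w => Subtype.ext ?_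
    -- Every `w` admits such a `γ`, so the prescribed formula determines all values of `Ψ`.
    obtain ⟨γ, hγ, -⟩ := T.existsUnique_translation w.2
    exact (hΨ w γ hγ).trans (T.stabilizerEquiv_symm_apply w hγ).symm
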